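/- Let $\hbar>0$, $m_1,\dots,m_N>0$, let $U:\mathbb R^N\to\mathbb R$ be measurable, and let $H$ be a self-adjoint realization on $L^2(\mathbb R^N)$ of the Hamiltonian $\sum_{n=1}^N \hat p_n^2/(2m_n)+U(\hat x)$ (a self-adjoint extension of this operator, assumed densely defined on the intersection of the domains of its two terms). Let $\Psi_0$ be a normalized eigenvector of $H$ (for instance the ground state) with $\langle\Psi_0|\hat p_n|\Psi_0\rangle=0$ for all $n$, whose momentum-space wavefunction $\Psi_0(p)=\langle p|\Psi_0\rangle$ is nonzero for almost every $p$ (for instance everywhere except at isolated points). Consider the translation-invariant Markovian master equation $$\frac{\partial\rho}{\partial t}=\mathcal L[\rho]=\frac{i}{\hbar}[\rho,H]+\mathcal L_{\rm rel}[\rho],\qquad \mathcal L_{\rm rel}[\rho]=\sum_{k=1}^K\Bigl(A_k\rho A_k^\dagger-\tfrac12(A_k^\dagger A_k\rho+\rho A_k^\dagger A_k)\Bigr)-i\,[\kappa_{\rm aux}\cdot\hat x+f_{\rm aux}(\hat p),\rho],\qquad A_k=e^{-i\kappa_k\cdot\hat x}f_k(\hat p),$$ where $\kappa_k,\kappa_{\rm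 aux}\in\mathbb R^N$, $f_k:\mathbb R^N\to\mathbb C$ and $f_{\rm aux}:\mathbb R^N\to\mathbb R$ are measurable, and all operators (in general unbounded) have their natural domains. A solution is a family $\rho(t)$, $t\ge 0$, of density operators such that $\frac{d}{dt}\langle\varphi|\rho(t)|\chi\rangle=\langle\varphi|\mathcal L[\rho(t)]|\chi\rangle$ for all $t\ge0$ and all $\varphi,\chi$ in the common domain $\mathcal D$ of $H$ and of the operators $A_k^\dagger$, $A_k^\dagger A_k$, $\kappa_{\rm aux}\cdot\hat x+f_{\rm aux}(\hat p)$, these operators acting on $\varphi$ and $\chi$. The unbounded generator is assumed to be meaningful in the following sense: every $\varphi$ whose momentum-space wavefunction is smooth and compactly supported is in the domains of $A_k^\dagger$, $A_k^\dagger A_k$ and $\kappa_{\rm aux}\cdot\hat x+f_{\rm aux}(\hat p)$, and there are $\varphi_j\in\mathcal D$ with $\varphi_j\to\varphi$ such that the images of $\varphi_j$ under each of these operators converge to the images of $\varphi$. (If $\kappa_{\rm aux}=0$ and $f_k$, $f_{\rm aux}$ are bounded, this holds for every $H$.) Then no such process can steer the system to $|\Psi_0\rangle$: if a solution satisfies $\rho(t)\to|\Psi_0\rangle\langle\Psi_0|$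 as $t\to\infty$ (in the sense that all matrix elements converge), then $\rho(t)=|\Psi_0\rangle\langle\Psi_0|$ for all $t\ge 0$. Moreover, $|\Psi_0\rangle\langle\Psi_0|$ can be a fixed point (a constant solution) only if $\mathcal L_{\rm rel}$ vanishes identically, that is, $\langle\varphi|\mathcal L_{\rm rel}[\rho]|\chi\rangle=0$ for every bounded operator $\rho$ and all $\varphi,\chi$ in the common domain of $A_k^\dagger$, $A_k^\dagger A_k$ and $\kappa_{\rm aux}\cdot\hat x+f_{\rm aux}(\hat p)$. -/

import Mathlib

open MeasureTheory Filter Topology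
open scoped InnerProductSpace FourierTransform ContDiff LinearPMap

noncomputable section

namespace NoGo

/-- Configuration space `ℝ^N`; it also serves as momentum space. -/
abbrev Config (N : ℕ) : Type := EuclideanSpace ℝ (Fin N)

/-- The Hilbert space `L²(ℝ^N; ℂ)` of wavefunctions in the position representation. -/
abbrev Wave (N : ℕ) : Type := Lp ℂ 2 (volume : Measure (Config N))

/-! ### Unbounded operators -/

/-- The operator of multiplication by `g`, on its maximal domain. -/
def mulOp {N : ℕ} (g : Config N → ℂ) : Wave N →ₗ.[ℂ] Wave N where
  domain :=
    { carrier := {ψ | MemLp (fun x => g x * ψ x) 2 volume}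
      add_mem' := by
        intro a b ha hb
        refine (MemLp.add ha hb).ae_eq ?_
        filter_upwards [Lp.coeFn_add a b] with x hx
        rw [hx, Pi.add_apply, Pi.add_apply, mul_add]
      zero_mem' := by
        refine (MemLp.zero' (ε := ℂ)).ae_eq ?_
        filter_upwards [Lp.coeFn_zero ℂ 2 (volume : Measure (Config N))] with x hx
        rw [hx, Pi.zero_apply, mul_zero]
      smul_mem' := by
        intro c a ha
        refine (MemLp.const_smul ha c).ae_eq ?_
        filter_upwards [Lp.coeFn_smul c a] with x hx
        rw [hx, Pi.smul_apply, Pi.smul_apply, smul_eq_mul, smul_eq_mul, mul_left_comm] }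
  toFun :=
    { toFun := fun ψ => MemLp.toLp (fun x => g x * (ψ : Wave N) x) ψ.2
      map_add' := by
        intro a b
        apply Lp.ext
        refine (MemLp.coeFn_toLp _).trans ?_
        refine EventuallyEq.trans ?_ (Lp.coeFn_add _ _).symm
        filter_upwards [Lp.coeFn_add (a : Wave N) b, MemLp.coeFn_toLp a.2,
          MemLp.coeFn_toLp b.2] with x h1 h2 h3
        simp only [Submodule.coe_add, Pi.add_apply] at *
        rw [h1, h2, h3, mul_add]
      map_smul' := by
        intro c a
        apply Lp.ext
        refine (MemLp.coeFn_toLp _).trans ?_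
        refine EventuallyEq.trans ?_ (Lp.coeFn_smul _ _).symm
        filter_upwards [Lp.coeFn_smul c (a : Wave N), MemLp.coeFn_toLp a.2] with x h1 h2
        simp only [Submodule.coe_smul, Pi.smul_apply, smul_eq_mul, RingHom.id_apply] at *
        rw [h1, h2, mul_left_comm] }

/-- The unitary Fourier transform on `L²`, with kernel `e^{-2πi ξ·x}`.  The momentum variable is
`p = 2πħ ξ`. -/
def fourierL2 (N : ℕ) : Wave N ≃ₗᵢ[ℂ] Wave N := Lp.fourierTransformₗᵢ (Config N) ℂ

/-- The function `f(p̂)` of the momentum operator `p̂ = -iħ∇`, on its maximal domain: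
multiplication by `f(p)` in the momentum representation, where `p = 2πħ ξ`. -/
def momOp {N : ℕ} (hb : ℝ) (f : Config N → ℂ) : Wave N →ₗ.[ℂ] Wave N where
  domain := (mulOp fun ξ => f ((2 * Real.pi * hb) • ξ)).domain.comap
    (fourierL2 N).toLinearEquiv.toLinearMap
  toFun :=
    (fourierL2 N).symm.toLinearEquiv.toLinearMap ∘ₗ
      (mulOp fun ξ => f ((2 * Real.pi * hb) • ξ)).toFun ∘ₗ
        ((fourierL2 N).toLinearEquiv.toLinearMap.restrict (fun _ h => h))

/-- The momentum-space wavefunction `Ψ(p) = (2πħ)^{-N/2} ∫ e^{-ip·x/ħ} Ψ(x) dx`. -/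
def momentumWave {N : ℕ} (hb : ℝ) (ψ : Wave N) (p : Config N) : ℂ :=
  (((2 * Real.pi * hb) ^ (-(N : ℝ) / 2) : ℝ) : ℂ) *
    (fourierL2 N ψ) ((2 * Real.pi * hb)⁻¹ • p)

/-- The product `A B` of two unbounded operators, on its natural domain
`{φ ∈ D(B) | B φ ∈ D(A)}`. -/
def opMul {V : Type*} [AddCommGroup V] [Module ℂ V] (A B : V →ₗ.[ℂ] V) : V →ₗ.[ℂ] V where
  domain := (A.domain.comap B.toFun).map B.domain.subtype
  toFun :=
    { toFun := fun φ => A ⟨B ⟨φ, by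
          obtain ⟨y, _, hy⟩ := φ.2
          rw [← hy]; exact y.2⟩, by
          obtain ⟨y, hy, hy'⟩ := φ.2
          have : (⟨(φ : V), by rw [← hy']; exact y.2⟩ : B.domain) = y := Subtype.ext hy'.symm
          rw [this]; exact hy⟩
      map_add' := by
        intro a b
        rw [← A.map_add]
        congr 1
        apply Subtype.ext
        simp only [Submodule.coe_add]
        rw [← B.map_add]
        rfl
      map_smul' := by
        intro c a
        rw [RingHom.id_apply, ← A.map_smul]
        congr 1
        apply Subtype.ext
        simp only [Submodule.coe_smul]
        rw [← B.map_smul]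
        rfl }

/-! ### The Hamiltonian -/

/-- The formal Hamiltonian `∑ₙ p̂ₙ²/(2mₙ) + U(x̂)`, defined on the intersection of the domains of
its two terms. -/
def formalHamiltonian {N : ℕ} (hb : ℝ) (m : Fin N → ℝ) (U : Config N → ℝ) :
    Wave N →ₗ.[ℂ] Wave N :=
  momOp hb (fun p => ((∑ n, p n ^ 2 / (2 * m n) : ℝ) : ℂ)) + mulOp (fun x => (U x : ℂ))

/-- `H` is a self-adjoint realization of the (densely defined) operator
`∑ₙ p̂ₙ²/(2mₙ) + U(x̂)`. -/
structure IsHamiltonian {N : ℕ} (hb : ℝ) (m : Fin N → ℝ) (U : Config N → ℝ)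
    (H : Wave N →ₗ.[ℂ] Wave N) : Prop where
  dense_formal : Dense ((formalHamiltonian hb m U).domain : Set (Wave N))
  formal_le : formalHamiltonian hb m U ≤ H
  selfAdjoint : IsSelfAdjoint H

/-! ### Lindblad generators in weak form

For an operator `ρ` and vectors `φ`, `χ` in the appropriate domains, the matrix element
`⟨φ| 𝓛[ρ] |χ⟩` is written with all unbounded operators acting on `φ` and `χ`. -/

section forms

variable {V : Type*} [NormedAddCommGroup V] [InnerProductSpace ℂ V] [CompleteSpace V]

/-- The matrix element `⟨φ| [H, ρ] |χ⟩` of a commutator with a symmetric operator `H`. -/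
def commForm (H : V →ₗ.[ℂ] V) (ρ : V →L[ℂ] V) (φ χ : V) (hφ : φ ∈ H.domain)
    (hχ : χ ∈ H.domain) : ℂ :=
  ⟪H ⟨φ, hφ⟩, ρ χ⟫_ℂ - ⟪φ, ρ (H ⟨χ, hχ⟩)⟫_ℂ

/-- The vectors on which both `L†` and `L† L` are defined. -/
def dissDomain (L : V →ₗ.[ℂ] V) : Submodule ℂ V := L†.domain ⊓ (opMul L† L).domain

/-- The matrix element `⟨φ| 𝓓_L[ρ] |χ⟩` of the dissipator
`𝓓_L[ρ] = L ρ L† - (1/2) (L† L ρ + ρ L† L)`. -/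
def dissForm (L : V →ₗ.[ℂ] V) (ρ : V →L[ℂ] V) (φ χ : V) (hφ : φ ∈ dissDomain L)
    (hχ : χ ∈ dissDomain L) : ℂ :=
  ⟪L† ⟨φ, hφ.1⟩, ρ (L† ⟨χ, hχ.1⟩)⟫_ℂ
    - (1 / 2) * (⟪opMul L† L ⟨φ, hφ.2⟩, ρ χ⟫_ℂ + ⟪φ, ρ (opMul L† L ⟨χ, hχ.2⟩)⟫_ℂ)

/-- A density operator: positive, of trace one. -/
def IsDensityOperator (ρ : V →L[ℂ] V) : Prop :=
  ρ.IsPositive ∧ ∀ (ι : Type) (b : HilbertBasis ι ℂ V), HasSum (fun i => ⟪b i, ρ (b i)⟫_ℂ) 1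

end forms

/-! ### Translation-invariant relaxation -/

/-- The data of the translation-invariant superoperator
`𝓛_rel = ∑ₖ 𝓓_{Aₖ} - i [κ_aux·x̂ + f_aux(p̂), ·]` with `Aₖ = e^{-iκₖ·x̂} fₖ(p̂)`. -/
structure TransInvRelaxation (N K : ℕ) where
  κ : Fin K → Config N
  f : Fin K → Config N → ℂ
  κaux : Config N
  faux : Config N → ℝ
  measurable_f : ∀ k, Measurable (f k)
  measurable_faux : Measurable faux

namespace TransInvRelaxation

variable {N K : ℕ} (R : TransInvRelaxation N K) (hb : ℝ)

/-- `Aₖ = e^{-iκₖ·x̂} fₖ(p̂)`. -/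
def A (k : Fin K) : Wave N →ₗ.[ℂ] Wave N :=
  opMul (mulOp fun x => Complex.exp (-Complex.I * ((⟪R.κ k, x⟫_ℝ : ℝ) : ℂ))) (momOp hb (R.f k))

/-- `κ_aux·x̂ + f_aux(p̂)`. -/
def drift : Wave N →ₗ.[ℂ] Wave N :=
  mulOp (fun x => ((⟪R.κaux, x⟫_ℝ : ℝ) : ℂ)) + momOp hb (fun p => (R.faux p : ℂ))

/-- The vectors to which all the operators occurring in `𝓛_rel` can be applied. -/
def relDomain : Submodule ℂ (Wave N) :=
  (⨅ k, dissDomain (R.A hb k)) ⊓ (R.drift hb).domain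

theorem relDomain_diss {φ : Wave N} (h : φ ∈ R.relDomain hb) (k : Fin K) :
    φ ∈ dissDomain (R.A hb k) :=
  (Submodule.mem_iInf _).1 h.1 k

/-- The matrix element `⟨φ| 𝓛_rel[ρ] |χ⟩`. -/
def relForm (ρ : Wave N →L[ℂ] Wave N) (φ χ : Wave N) (hφ : φ ∈ R.relDomain hb)
    (hχ : χ ∈ R.relDomain hb) : ℂ :=
  (∑ k, dissForm (R.A hb k) ρ φ χ (R.relDomain_diss hb hφ k) (R.relDomain_diss hb hχ k))
    - Complex.I * commForm (R.drift hb) ρ φ χ hφ.2 hχ.2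

/-- The vectors to which all the operators occurring in the full generator
`𝓛 = (i/ħ)[·, H] + 𝓛_rel` can be applied. -/
def genDomain (H : Wave N →ₗ.[ℂ] Wave N) : Submodule ℂ (Wave N) :=
  H.domain ⊓ R.relDomain hb

/-- The matrix element `⟨φ| 𝓛[ρ] |χ⟩ = ⟨φ| (i/ħ)[ρ, H] |χ⟩ + ⟨φ| 𝓛_rel[ρ] |χ⟩`. -/
def genForm (H : Wave N →ₗ.[ℂ] Wave N) (ρ : Wave N →L[ℂ] Wave N) (φ χ : Wave N)
    (hφ : φ ∈ R.genDomain hb H) (hχ : χ ∈ R.genDomain hb H) : ℂ :=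
  -(Complex.I / hb) * commForm H ρ φ χ hφ.1 hχ.1 + R.relForm hb ρ φ χ hφ.2 hχ.2

/-- `ρ : [0, ∞) → {density operators}` is a (weak) solution of the master equation
`∂ρ/∂t = 𝓛[ρ]`. -/
structure IsSolution (H : Wave N →ₗ.[ℂ] Wave N) (ρ : ℝ → (Wave N →L[ℂ] Wave N)) : Prop where
  density : ∀ t, 0 ≤ t → IsDensityOperator (ρ t)
  equation : ∀ (φ χ : Wave N) (hφ : φ ∈ R.genDomain hb H) (hχ : χ ∈ R.genDomain hb H) (t : ℝ),
    0 ≤ t → HasDerivWithinAt (fun s => ⟪φ, ρ s χ⟫_ℂ) (R.genForm hb H (ρ t) φ χ hφ hχ)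
      (Set.Ici 0) t

/-- A wavefunction that is smooth and compactly supported in the momentum representation. -/
def _root_.NoGo.IsMomentumTest {N : ℕ} (φ : Wave N) : Prop :=
  ∃ g : Config N → ℂ, ContDiff ℝ ∞ g ∧ HasCompactSupport g ∧ fourierL2 N φ =ᵐ[volume] g

/-- The sum of unbounded operators that makes up the generator is meaningful: the relaxation
operators `Aₖ†`, `Aₖ† Aₖ` and `κ_aux·x̂ + f_aux(p̂)` can be applied to all momentum-space test
functions, and their values there are limits of their values on the common domain with `H`.
(If `κ_aux = 0` and the functions `fₖ`, `f_aux` are bounded this holds for every `H`.) -/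
def HasCore (H : Wave N →ₗ.[ℂ] Wave N) : Prop :=
  ∀ φ : Wave N, IsMomentumTest φ → ∃ hφ : φ ∈ R.relDomain hb,
    ∃ u : ℕ → R.genDomain hb H,
      Tendsto (fun n => (u n : Wave N)) atTop (𝓝 φ) ∧
      (∀ k, Tendsto (fun n => (R.A hb k)† ⟨u n, (R.relDomain_diss hb (u n).2.2 k).1⟩) atTop
        (𝓝 ((R.A hb k)† ⟨φ, (R.relDomain_diss hb hφ k).1⟩))) ∧
      (∀ k, Tendsto (fun n => opMul (R.A hb k)† (R.A hb k)
          ⟨u n, (R.relDomain_diss hb (u n).2.2 k).2⟩) atTop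
        (𝓝 (opMul (R.A hb k)† (R.A hb k) ⟨φ, (R.relDomain_diss hb hφ k).2⟩))) ∧
      Tendsto (fun n => R.drift hb ⟨u n, (u n).2.2.2⟩) atTop (𝓝 (R.drift hb ⟨φ, hφ.2⟩))

end TransInvRelaxation

/-- The pure state `|Ψ⟩⟨Ψ|`. -/
def pureState {N : ℕ} (Ψ : Wave N) : Wave N →L[ℂ] Wave N := InnerProductSpace.rankOne ℂ Ψ Ψ

/-- The evolution `ρ` steers the system to the state `σ`: `ρ(t) → σ` as `t → ∞`, in the sense
that all matrix elements converge. (For density operators `ρ(t)`, `σ` this is equivalent to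
convergence in trace norm.) -/
def SteersTo {N : ℕ} (ρ : ℝ → (Wave N →L[ℂ] Wave N)) (σ : Wave N →L[ℂ] Wave N) : Prop :=
  ∀ φ χ : Wave N, Tendsto (fun t => ⟪φ, ρ t χ⟫_ℂ) atTop (𝓝 ⟪φ, σ χ⟫_ℂ)

end NoGo

end

/-! A limit state is stationary: if `⟨φ|ρ(t)|χ⟩` and its derivative both converge, the derivative
tends to zero (`deriv_limit_eq_zero`). The Hamiltonian contributes nothing on `|Ψ⟩⟨Ψ|` because `Ψ`
is an eigenvector, so the relaxation part alone annihilates `|Ψ⟩⟨Ψ|`, first on the common domain and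
then, by the core condition, on momentum-space test functions.

Stationarity of a pure state makes `Ψ` a weak eigenvector of every `Aₖ` and of the non-Hermitian
operator built from the drift and the `Aₖ† Aₖ`, with `2 Re z = ∑ |cₖ|²` relating the eigenvalues
(`functionals_proportional`, `exists_eigenvalues`). Let `u` be the conjugate of the momentum
wavefunction, in the variable `ξ = p/(2πħ)`, and write `fₖ` in this variable too. The eigenvalue
equations become `conj fₖ(ξ) u(ξ) = cₖ u(ξ - aₖ)`, with `aₖ` the kick, and a first-order weak
equation for `u` along `v = κ_aux`. For `P = |u|²` the unknown `fₖ` and `f_aux` drop out, leaving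
`∂ᵥ P(ξ) = 2π ∑ |cₖ|² (P(ξ - aₖ) - P(ξ))`. Thus `P` is an integrable stationary density of jumps
with drift. Its Fourier transform is nonzero near the origin, and comparing real and then imaginary
parts of the symbols there excludes every genuine jump and the drift (`jumps_and_drift_trivial`).

Since `u ≠ 0` almost everywhere, the eigenvalue equations now force each `Aₖ` and the drift operator
to be scalars (`isScalar_of_stationary`), and scalars generate no relaxation. The overlap
`⟨Ψ|ρ(t)|Ψ⟩` is then conserved. Its limit is one, so it is one at all times, and a density operator
with that overlap is `|Ψ⟩⟨Ψ|` (`IsDensityOperator.eq_rankOne`).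

The weak equation along `v` only gives local integrability, so it is converted into an integral
identity on almost every line, where absolute continuity justifies the product rule for `|u|²`
(`ae_norm_sq_eq_line_integral`). -/

namespace NoGo

open Complex ComplexConjugate ComplexOrder

/-- If `u` and its derivative `u'` both converge at infinity, then the derivative converges to
zero. -/
theorem deriv_limit_eq_zero {u u' : ℝ → ℂ} {a b : ℂ}
    (hu : ∀ t, 0 ≤ t → HasDerivWithinAt u (u' t) (Set.Ici 0) t)
    (ha : Tendsto u atTop (𝓝 a)) (hb : Tendsto u' atTop (𝓝 b)) : b = 0 := by
  have h1 : Tendsto (fun t : ℝ => u (t + 1) - u t - b) atTop (𝓝 (a - a - b)) :=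
    ((ha.comp (tendsto_atTop_add_const_right _ 1 tendsto_id)).sub ha).sub_const b
  have h2 : Tendsto (fun t : ℝ => u (t + 1) - u t - b) atTop (𝓝 0) := by
    rw [Metric.tendsto_atTop] at hb ⊢
    intro ε hε
    obtain ⟨T, hT⟩ := hb (ε / 2) (half_pos hε)
    refine ⟨max T 0, fun t ht => ?_⟩
    have ht0 : 0 ≤ t := (le_max_right _ _).trans ht
    -- Mean value inequality on `[t, t + 1]` for `u(s) - s b`, whose derivative is eventually small.
    have key := Convex.norm_image_sub_le_of_norm_hasDerivWithin_le
      (f := fun s : ℝ => u s - (s : ℂ) * b) (f' := fun s => u' s - 1 * b)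
      (s := Set.Ici t) (C := ε / 2) (x := t) (y := t + 1)
      (fun s hs => ((hu s (ht0.trans hs)).mono (Set.Ici_subset_Ici.2 ht0)).sub
        ((HasDerivAt.ofReal_comp (hasDerivAt_id s)).hasDerivWithinAt.mul_const b))
      (fun s hs => by
        have := hT s ((le_max_left _ _).trans (ht.le.trans hs))
        rw [dist_eq_norm] at this
        rw [one_mul]
        exact this.le)
      (convex_Ici t) (Set.mem_Ici.2 le_rfl) (Set.mem_Ici.2 (by linarith))
    rw [dist_eq_norm, sub_zero]
    have e : u (t + 1) - ((t + 1 : ℝ) : ℂ) * b - (u t - (t : ℂ) * b) = u (t + 1) - u t - b := by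
      push_cast; ring
    have e' : ‖t + 1 - t‖ = 1 := by simp
    simp only [e, e', mul_one] at key
    linarith
  have := tendsto_nhds_unique h1 h2
  simpa using this

/-! ### Positive, density and scalar operators on a Hilbert space -/

section

variable {V : Type} [NormedAddCommGroup V] [InnerProductSpace ℂ V]

/-- A positive operator kills the vectors on which its quadratic form vanishes. -/
theorem apply_eq_zero_of_inner_eq_zero {ρ : V →L[ℂ] V} (hρ : ρ.IsPositive) {x : V}
    (hx : ⟪x, ρ x⟫_ℂ = 0) : ρ x = 0 := by
  have hsym := hρ.inner_left_eq_inner_right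
  have key : ∀ s : ℝ, 0 ≤ 2 * s * ‖ρ x‖ ^ 2 + s ^ 2 * (⟪ρ x, ρ (ρ x)⟫_ℂ).re := by
    intro s
    have h := hρ.re_inner_nonneg_right (x + (s : ℂ) • ρ x)
    have h3 : ⟪x, ρ (ρ x)⟫_ℂ = ⟪ρ x, ρ x⟫_ℂ := (hsym x (ρ x)).symm
    simp only [map_add, map_smul, inner_add_left, inner_add_right, inner_smul_left,
      inner_smul_right, hx, h3, inner_self_eq_norm_sq_to_K, conj_ofReal] at h
    simp only [RCLike.re_to_complex] at h
    simp only [add_re, mul_re, ofReal_re, ofReal_im, zero_mul, sub_zero, zero_re] at h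
    have e : (((‖ρ x‖ : ℂ)) ^ 2).re = ‖ρ x‖ ^ 2 := by
      rw [← ofReal_pow, ofReal_re]
    simp only [coe_algebraMap, e] at h
    nlinarith
  by_contra hne
  have hpos : 0 < ‖ρ x‖ ^ 2 := by positivity
  set B := (⟪ρ x, ρ (ρ x)⟫_ℂ).re
  have hB : 0 ≤ B := hρ.re_inner_nonneg_right (ρ x)
  -- The quadratic in `s` has no constant term, so a small negative `s` violates `key` unless its
  -- linear coefficient vanishes; `B + 1` rather than `B` keeps the denominator positive.
  have := key (-(‖ρ x‖ ^ 2 / (B + 1)))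
  have hB1 : 0 < B + 1 := by linarith
  have e : 2 * (-(‖ρ x‖ ^ 2 / (B + 1))) * ‖ρ x‖ ^ 2 + (-(‖ρ x‖ ^ 2 / (B + 1))) ^ 2 * B
      = -((‖ρ x‖ ^ 2) ^ 2 * (B + 2) / (B + 1) ^ 2) := by
    field_simp; ring
  rw [e] at this
  have : 0 < (‖ρ x‖ ^ 2) ^ 2 * (B + 2) / (B + 1) ^ 2 := by positivity
  linarith

/-- A partially defined operator that is in fact multiplication by the number `c`, everywhere. -/
def IsScalar (T : V →ₗ.[ℂ] V) (c : ℂ) : Prop := ∀ x, ∃ h : x ∈ T.domain, T ⟨x, h⟩ = c • x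

theorem opMul_apply_of_mem {A B : V →ₗ.[ℂ] V} {x : V} (hB : x ∈ B.domain)
    (hA : B ⟨x, hB⟩ ∈ A.domain) : ∃ h : x ∈ (opMul A B).domain,
      opMul A B ⟨x, h⟩ = A ⟨B ⟨x, hB⟩, hA⟩ :=
  ⟨⟨⟨x, hB⟩, hA, rfl⟩, rfl⟩

theorem exists_of_mem_opMul {A B : V →ₗ.[ℂ] V} {x : V} (hx : x ∈ (opMul A B).domain) :
    ∃ (hB : x ∈ B.domain) (hA : B ⟨x, hB⟩ ∈ A.domain),
      opMul A B ⟨x, hx⟩ = A ⟨B ⟨x, hB⟩, hA⟩ := by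
  obtain ⟨y, hy, rfl⟩ := hx
  exact ⟨y.2, hy, rfl⟩

theorem IsScalar.opMul {A B : V →ₗ.[ℂ] V} {a b : ℂ} (hA : IsScalar A a) (hB : IsScalar B b) :
    IsScalar (opMul A B) (a * b) := by
  intro x
  obtain ⟨hx, hx'⟩ := hB x
  obtain ⟨hy, hy'⟩ := hA (B ⟨x, hx⟩)
  obtain ⟨h, h'⟩ := opMul_apply_of_mem hx hy
  exact ⟨h, by rw [h', hy', hx', smul_smul]⟩

theorem IsScalar.add {A B : V →ₗ.[ℂ] V} {a b : ℂ} (hA : IsScalar A a) (hB : IsScalar B b) :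
    IsScalar (A + B) (a + b) := by
  intro x
  obtain ⟨hx, hx'⟩ := hA x
  obtain ⟨hy, hy'⟩ := hB x
  exact ⟨⟨hx, hy⟩, by rw [add_smul, ← hx', ← hy']; rfl⟩

theorem IsScalar.commForm_eq_zero {D : V →ₗ.[ℂ] V} {r : ℂ} (h : IsScalar D r) (hr : conj r = r)
    (ρ : V →L[ℂ] V) (φ χ : V) (hφ : φ ∈ D.domain) (hχ : χ ∈ D.domain) :
    commForm D ρ φ χ hφ hχ = 0 := by
  unfold commForm
  rw [(h φ).2, (h χ).2]
  simp only [map_smul, inner_smul_left, inner_smul_right, hr, sub_self]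

variable [CompleteSpace V]

/-- A density operator with expectation one in the state `Ψ` is `|Ψ⟩⟨Ψ|`. -/
theorem IsDensityOperator.eq_rankOne {ρ : V →L[ℂ] V} (hρ : IsDensityOperator ρ) {Ψ : V}
    (hΨ : ‖Ψ‖ = 1) (h1 : ⟪Ψ, ρ Ψ⟫_ℂ = 1) : ρ = InnerProductSpace.rankOne ℂ Ψ Ψ := by
  classical
  have hs : Orthonormal ℂ ((↑) : ({Ψ} : Set V) → V) := by
    constructor
    · rintro ⟨x, rfl⟩; exact hΨ
    · rintro ⟨x, rfl⟩ ⟨y, rfl⟩ h; exact absurd rfl h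
  obtain ⟨w, b, hw, hb⟩ := hs.exists_hilbertBasis_extension
  set i₀ : w := ⟨Ψ, hw rfl⟩
  have hb0 : b i₀ = Ψ := by rw [hb]
  have htr := (hρ.2 w b).mapL reCLM
  have h0 : ∀ i, i ≠ i₀ → ρ (b i) = 0 := by
    intro i hi
    apply apply_eq_zero_of_inner_eq_zero hρ.1
    have hnn : ∀ j, 0 ≤ ⟪b j, ρ (b j)⟫_ℂ := fun j => hρ.1.inner_nonneg_right (b j)
    have hre : ∀ j, 0 ≤ reCLM ⟪b j, ρ (b j)⟫_ℂ := fun j => (Complex.le_def.1 (hnn j)).1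
    -- The diagonal entries are nonnegative with sum one, and the entry at `Ψ` already exhausts it.
    have hle := sum_le_hasSum {i, i₀} (fun j _ => hre j) htr
    rw [Finset.sum_pair hi, hb0] at hle
    simp only [reCLM_apply, h1, one_re] at hle
    apply Complex.ext
    · exact le_antisymm (by simpa using hle) (Complex.le_def.1 (hnn i)).1
    · exact (Complex.le_def.1 (hnn i)).2.symm
  have hΨb : ∀ i, i ≠ i₀ → ⟪b i, Ψ⟫_ℂ = 0 := fun i hi => by
    rw [← hb0]; exact b.orthonormal.2 hi
  have hΨ0 : ρ Ψ = Ψ := by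
    apply b.repr.injective
    ext i
    rw [b.repr_apply_apply, b.repr_apply_apply]
    by_cases hi : i = i₀
    · rw [hi, hb0, h1, inner_self_eq_norm_sq_to_K, hΨ]; simp
    · rw [← hρ.1.inner_left_eq_inner_right, h0 i hi, inner_zero_left, hΨb i hi]
  ext x
  apply b.repr.injective
  ext i
  rw [b.repr_apply_apply, b.repr_apply_apply, InnerProductSpace.rankOne_apply, inner_smul_right,
    ← hρ.1.inner_left_eq_inner_right]
  by_cases hi : i = i₀
  · rw [hi, hb0, hΨ0, inner_self_eq_norm_sq_to_K, hΨ]; simp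
  · rw [h0 i hi, inner_zero_left, hΨb i hi, mul_zero]

theorem IsScalar.adjoint {T : V →ₗ.[ℂ] V} {c : ℂ} (h : IsScalar T c) : IsScalar T† (conj c) := by
  have hd : Dense (T.domain : Set V) := by
    rw [show (T.domain : Set V) = Set.univ from Set.eq_univ_of_forall fun x => (h x).1]
    exact dense_univ
  have hin : ∀ x : V, ∀ y : T.domain, ⟪conj c • x, (y : V)⟫_ℂ = ⟪x, T y⟫_ℂ := by
    intro x y
    rw [(h y).2, inner_smul_left, inner_smul_right, conj_conj]
  intro x
  exact ⟨LinearPMap.mem_adjoint_domain_of_exists x ⟨_, hin x⟩,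
    LinearPMap.adjoint_apply_eq hd _ (hin x)⟩

theorem IsScalar.mem_dissDomain {L : V →ₗ.[ℂ] V} {c : ℂ} (h : IsScalar L c) (x : V) :
    x ∈ dissDomain L :=
  ⟨(h.adjoint x).1, ((h.adjoint.opMul h) x).1⟩

/-- The gain term is `|c|² ρ`, and the two halves of the loss term add up to the same. -/
theorem IsScalar.dissForm_eq_zero {L : V →ₗ.[ℂ] V} {c : ℂ} (h : IsScalar L c) (ρ : V →L[ℂ] V)
    (φ χ : V) (hφ : φ ∈ dissDomain L) (hχ : χ ∈ dissDomain L) : dissForm L ρ φ χ hφ hχ = 0 := by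
  unfold dissForm
  rw [(h.adjoint φ).2, (h.adjoint χ).2, ((h.adjoint.opMul h) φ).2, ((h.adjoint.opMul h) χ).2]
  simp only [map_smul, inner_smul_left, inner_smul_right, conj_conj, map_mul]
  ring

end

/-- If `∑ₖ ℓₖ ⊗ ℓₖ̄ = w ⊗ ℓ̄ + ℓ ⊗ w̄` for linear functionals, all of them are multiples of `ℓ`. -/
theorem functionals_proportional {T : Type*} [AddCommGroup T] [Module ℂ T] {K : ℕ}
    (ℓ : Fin K → T →ₗ[ℂ] ℂ) (ℓ₀ w : T →ₗ[ℂ] ℂ)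
    (h : ∀ φ χ, ∑ k, conj (ℓ k φ) * ℓ k χ = conj (w φ) * ℓ₀ χ + conj (ℓ₀ φ) * w χ)
    {χ₀ : T} (hχ₀ : ℓ₀ χ₀ ≠ 0) :
    ∃ (c : Fin K → ℂ) (z : ℂ), (∀ k φ, ℓ k φ = c k * ℓ₀ φ) ∧ (∀ φ, w φ = z * ℓ₀ φ) ∧
      2 * z.re = ∑ k, ‖c k‖ ^ 2 := by
  -- On the kernel of `ℓ₀` the diagonal of `h` is a sum of squares equal to zero.
  have hker : ∀ k φ, ℓ₀ φ = 0 → ℓ k φ = 0 := by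
    intro k φ hφ
    have h1 := h φ φ
    simp only [hφ, mul_zero, map_zero, zero_mul, add_zero, conj_mul'] at h1
    have h2 : ∑ k, ‖ℓ k φ‖ ^ 2 = 0 := by exact_mod_cast h1
    have h3 := (Finset.sum_eq_zero_iff_of_nonneg (fun k _ => by positivity)).1 h2 k
      (Finset.mem_univ k)
    simpa using h3
  have hc : ∀ k φ, ℓ k φ = ℓ k χ₀ / ℓ₀ χ₀ * ℓ₀ φ := by
    intro k φ
    have := hker k (φ - (ℓ₀ φ / ℓ₀ χ₀) • χ₀) (by simp [hχ₀])
    rw [map_sub, map_smul, sub_eq_zero, smul_eq_mul] at this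
    rw [this]; ring
  set c : Fin K → ℂ := fun k => ℓ k χ₀ / ℓ₀ χ₀ with hcdef
  have hsum : ∀ φ χ, conj (ℓ₀ φ) * ℓ₀ χ * ((∑ k, ‖c k‖ ^ 2 : ℝ) : ℂ)
      = conj (w φ) * ℓ₀ χ + conj (ℓ₀ φ) * w χ := by
    intro φ χ
    rw [← h, ofReal_sum, Finset.mul_sum]
    refine Finset.sum_congr rfl fun k _ => ?_
    rw [hc k φ, hc k χ, map_mul, ofReal_pow, ← conj_mul']
    ring
  have hwz : ∀ φ, w φ = w χ₀ / ℓ₀ χ₀ * ℓ₀ φ := by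
    intro φ
    -- Freezing the first argument at `χ₀` leaves a linear equation expressing `w` through `ℓ₀`.
    have e : ∀ φ, conj (ℓ₀ χ₀) * w φ
        = (conj (ℓ₀ χ₀) * ((∑ k, ‖c k‖ ^ 2 : ℝ) : ℂ) - conj (w χ₀)) * ℓ₀ φ := by
      intro φ
      linear_combination -hsum χ₀ φ
    have hc0 : conj (ℓ₀ χ₀) ≠ 0 := by simpa using hχ₀
    have e1 := e χ₀
    have e2 := e φ
    field_simp
    apply mul_left_cancel₀ hc0
    linear_combination ℓ₀ χ₀ * e2 - ℓ₀ φ * e1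
  refine ⟨c, w χ₀ / ℓ₀ χ₀, hc, hwz, ?_⟩
  have e := hsum χ₀ χ₀
  have hc0 : conj (ℓ₀ χ₀) ≠ 0 := by simpa using hχ₀
  have e3 : ((∑ k, ‖c k‖ ^ 2 : ℝ) : ℂ) = w χ₀ / ℓ₀ χ₀ + conj (w χ₀ / ℓ₀ χ₀) := by
    rw [map_div₀]
    field_simp
    linear_combination e
  rw [add_conj] at e3
  exact_mod_cast e3.symm

end NoGo

namespace NoGo

open Complex ComplexConjugate

/-! ### Functions along the lines of a fixed direction -/

/-- As `g` is merely integrable, its primitive is differentiable only almost everywhere. The real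
and imaginary parts are absolutely continuous, hence so is the sum of their squares, and the
fundamental theorem still applies. -/
theorem norm_sq_primitive {g : ℝ → ℂ} {s : ℝ} (hg : IntervalIntegrable g volume 0 s) (y₀ : ℂ) :
    ‖y₀ + ∫ r in (0 : ℝ)..s, g r‖ ^ 2 - ‖y₀‖ ^ 2
      = ∫ r in (0 : ℝ)..s, 2 * (conj (y₀ + ∫ q in (0 : ℝ)..r, g q) * g r).re := by
  have h0 : (0 : ℝ) ∈ Set.uIcc 0 s := Set.left_mem_uIcc
  have hre : IntervalIntegrable (fun r => (g r).re) volume 0 s :=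
    ⟨hg.1.re, hg.2.re⟩
  have him : IntervalIntegrable (fun r => (g r).im) volume 0 s :=
    ⟨hg.1.im, hg.2.im⟩
  have hsub : ∀ r ∈ Set.uIcc 0 s, IntervalIntegrable g volume 0 r := fun r hr =>
    hg.mono_set (Set.uIcc_subset_uIcc h0 hr)
  have ere : ∀ r ∈ Set.uIcc 0 s, (∫ q in (0 : ℝ)..r, g q).re = ∫ q in (0 : ℝ)..r, (g q).re :=
    fun r hr => (reCLM.intervalIntegral_comp_comm (hsub r hr)).symm
  have eim : ∀ r ∈ Set.uIcc 0 s, (∫ q in (0 : ℝ)..r, g q).im = ∫ q in (0 : ℝ)..r, (g q).im :=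
    fun r hr => (imCLM.intervalIntegral_comp_comm (hsub r hr)).symm
  set A : ℝ → ℝ := fun r => y₀.re + ∫ q in (0 : ℝ)..r, (g q).re
  set B : ℝ → ℝ := fun r => y₀.im + ∫ q in (0 : ℝ)..r, (g q).im
  have hconst : ∀ c : ℝ, AbsolutelyContinuousOnInterval (fun _ : ℝ => c) 0 s := fun c =>
    (LipschitzWith.const c).lipschitzOnWith.absolutelyContinuousOnInterval
  have hA : AbsolutelyContinuousOnInterval A 0 s :=
    (hconst _).add (hre.absolutelyContinuousOnInterval_intervalIntegral h0)
  have hB : AbsolutelyContinuousOnInterval B 0 s :=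
    (hconst _).add (him.absolutelyContinuousOnInterval_intervalIntegral h0)
  have hM := (hA.fun_mul hA).add (hB.fun_mul hB)
  have key := hM.integral_deriv_eq_sub
  have hns : ∀ r ∈ Set.uIcc 0 s,
      ‖y₀ + ∫ q in (0 : ℝ)..r, g q‖ ^ 2 = A r * A r + B r * B r := by
    intro r hr
    rw [← normSq_eq_norm_sq, normSq_apply, add_re, add_im, ere r hr, eim r hr]
  have hs0 : ‖y₀‖ ^ 2 = A 0 * A 0 + B 0 * B 0 := by
    simpa using hns 0 h0
  rw [hns s Set.right_mem_uIcc, hs0]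
  refine Eq.trans (by simpa using key.symm) ?_
  apply intervalIntegral.integral_congr_ae
  filter_upwards [hre.ae_hasDerivAt_integral, him.ae_hasDerivAt_integral] with r h1 h2 h3
  have hr : r ∈ Set.uIcc 0 s := Set.uIoc_subset_uIcc h3
  have dA : HasDerivAt A (g r).re r := (h1 hr 0 h0).const_add _
  have dB : HasDerivAt B (g r).im r := (h2 hr 0 h0).const_add _
  have := ((dA.mul dA).add (dB.mul dB)).deriv
  refine Eq.trans this ?_
  rw [mul_re, conj_re, conj_im, add_re, add_im, ere r hr, eim r hr]
  simp only [A, B]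
  ring

theorem exists_test_eq_one {E : Type*} [NormedAddCommGroup E] [InnerProductSpace ℝ E]
    [FiniteDimensional ℝ E] {K : Set E} (hK : IsCompact K) :
    ∃ g : E → ℝ, ContDiff ℝ ∞ g ∧ HasCompactSupport g ∧ ∀ ξ ∈ K, g ξ = 1 := by
  obtain ⟨R, hR0, hR⟩ := hK.isBounded.exists_pos_norm_le
  let b : ContDiffBump (0 : E) := ⟨R, R + 1, hR0, by linarith⟩
  exact ⟨b, b.contDiff, b.hasCompactSupport, fun ξ hξ =>
    b.one_of_mem_closedBall (mem_closedBall_zero_iff.2 (hR ξ hξ))⟩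

variable {E : Type*} [NormedAddCommGroup E] [InnerProductSpace ℝ E] [FiniteDimensional ℝ E]
  [MeasurableSpace E] [BorelSpace E]

/-- For each fixed parameter the shear is a translation. This transfers integrability from `E` to
families of parallel lines. -/
theorem measurePreserving_shear (v : E) (μ : Measure ℝ) [SFinite μ] :
    MeasurePreserving (fun p : E × ℝ => p.1 + p.2 • v) (volume.prod μ)
      (μ Set.univ • volume) := by
  have h : MeasurePreserving (fun p : ℝ × E => (p.1, p.2 + p.1 • v)) (μ.prod volume)
      (μ.prod volume) :=
    (MeasurePreserving.id μ).skew_product (g := fun r ξ => ξ + r • v) (by fun_prop)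
      (Eventually.of_forall fun r => (measurePreserving_add_right volume (r • v)).map_eq)
  have h1 : MeasurePreserving (Prod.snd : ℝ × E → E) (μ.prod volume) (μ Set.univ • volume) :=
    ⟨measurable_snd, by rw [Measure.map_snd_prod]⟩
  exact (h1.comp h).comp Measure.measurePreserving_swap

theorem integrable_shear {F : Type*} [NormedAddCommGroup F] {w : E → F} (hw : Integrable w) (v : E)
    (μ : Measure ℝ) [IsFiniteMeasure μ] :
    Integrable (fun p : E × ℝ => w (p.1 + p.2 • v)) (volume.prod μ) :=
  (measurePreserving_shear v μ).integrable_comp_of_integrable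
    (hw.smul_measure (measure_ne_top μ _))

theorem ae_integrable_line {w : E → ℂ} (hw : LocallyIntegrable w) (v : E) (s : ℝ) :
    ∀ᵐ ξ : E, IntegrableOn (fun r : ℝ => w (ξ + r • v)) (Set.Ioc 0 s) := by
  have h : ∀ n : ℕ, ∀ᵐ ξ : E, Integrable (fun r : ℝ =>
      (Metric.closedBall (0 : E) n).indicator w (ξ + r • v)) (volume.restrict (Set.Ioc 0 s)) := by
    intro n
    have h1 : Integrable ((Metric.closedBall (0 : E) n).indicator w) :=
      (integrable_indicator_iff measurableSet_closedBall).2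
        (hw.integrableOn_isCompact (isCompact_closedBall 0 (n : ℝ)))
    exact (integrable_shear h1 v (volume.restrict (Set.Ioc 0 s))).prod_right_ae
  filter_upwards [ae_all_iff.2 h] with ξ hξ
  obtain ⟨n, hn⟩ := exists_nat_ge (‖ξ‖ + s * ‖v‖)
  refine (hξ n).congr ?_
  filter_upwards [ae_restrict_mem measurableSet_Ioc] with r hr
  apply Set.indicator_of_mem
  rw [mem_closedBall_zero_iff]
  calc ‖ξ + r • v‖ ≤ ‖ξ‖ + ‖r • v‖ := norm_add_le _ _
    _ = ‖ξ‖ + r * ‖v‖ := by rw [norm_smul, Real.norm_of_nonneg hr.1.le]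
    _ ≤ ‖ξ‖ + s * ‖v‖ := by gcongr; exact hr.2
    _ ≤ n := hn

theorem integrable_smul_shear {w : E → ℂ} (hw : LocallyIntegrable w) {g : E → ℝ}
    (hg : Continuous g) (hgc : HasCompactSupport g) (v : E) (s : ℝ) :
    Integrable (fun p : E × ℝ => g p.1 • w (p.1 + p.2 • v))
      (volume.prod (volume.restrict (Set.Ioc 0 s))) := by
  obtain ⟨R, hR⟩ := hgc.isCompact.isBounded.exists_norm_le
  obtain ⟨M, hM⟩ := hg.bounded_above_of_compact_support hgc
  set K := Metric.closedBall (0 : E) (R + s * ‖v‖)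
  have h1 : Integrable (K.indicator w) :=
    (integrable_indicator_iff measurableSet_closedBall).2
      (hw.integrableOn_isCompact (isCompact_closedBall 0 _))
  have h2 := (integrable_shear h1 v (volume.restrict (Set.Ioc 0 s))).bdd_smul M
    (φ := fun p : E × ℝ => g p.1)
    (hg.comp continuous_fst).aestronglyMeasurable (Eventually.of_forall fun p => hM p.1)
  refine h2.congr ?_
  have h3 : ∀ᵐ p : E × ℝ ∂(volume.prod (volume.restrict (Set.Ioc 0 s))), p.2 ∈ Set.Ioc 0 s :=
    Measure.quasiMeasurePreserving_snd.ae (ae_restrict_mem measurableSet_Ioc)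
  filter_upwards [h3] with p hp
  by_cases hpg : g p.1 = 0
  · simp [hpg]
  · have : p.1 + p.2 • v ∈ K := by
      rw [mem_closedBall_zero_iff]
      calc ‖p.1 + p.2 • v‖ ≤ ‖p.1‖ + ‖p.2 • v‖ := norm_add_le _ _
        _ = ‖p.1‖ + p.2 * ‖v‖ := by rw [norm_smul, Real.norm_of_nonneg hp.1.le]
        _ ≤ R + s * ‖v‖ := by
          gcongr
          · exact hR _ (subset_tsupport _ hpg)
          · exact hp.2
    simp only [Pi.smul_apply', Set.indicator_of_mem this]

theorem locallyIntegrable_comp_add {w : E → ℂ} (hw : LocallyIntegrable w) (a : E) :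
    LocallyIntegrable fun ξ => w (ξ + a) := by
  rw [locallyIntegrable_iff] at hw ⊢
  intro K hK
  have h := hw _ (hK.image (continuous_add_const a))
  have := (measurePreserving_add_right (volume : Measure E) a).integrableOn_comp_preimage
    (f := w) (s := (fun x => x + a) '' K) (Homeomorph.addRight a).measurableEmbedding |>.2 h
  rwa [Set.preimage_image_eq _ (add_left_injective a)] at this

theorem locallyIntegrable_line_integral {w : E → ℂ} (hw : LocallyIntegrable w) (v : E) (s : ℝ) :
    LocallyIntegrable fun ξ => ∫ r in Set.Ioc 0 s, w (ξ + r • v) := by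
  rw [locallyIntegrable_iff]
  intro K hK
  obtain ⟨g, hg, hgc, hg1⟩ := exists_test_eq_one hK
  have h := (integrable_smul_shear hw hg.continuous hgc v s).integral_prod_left
  refine (h.integrableOn (s := K)).congr ?_
  filter_upwards [ae_restrict_mem hK.measurableSet] with ξ hξ
  simp [hg1 ξ hξ]

/-- A function whose distributional derivative in the direction `v` is locally integrable is the
integral of this derivative on almost all lines. -/
theorem ae_eq_line_integral {u w : E → ℂ} (hu : LocallyIntegrable u) (hw : LocallyIntegrable w)
    {v : E} (h : ∀ g : E → ℝ, ContDiff ℝ ∞ g → HasCompactSupport g →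
      ∫ ξ, (fderiv ℝ g ξ v) • u ξ = - ∫ ξ, g ξ • w ξ) {s : ℝ} (hs : 0 ≤ s) :
    ∀ᵐ ξ : E, u (ξ + s • v) - u ξ = ∫ r in Set.Ioc 0 s, w (ξ + r • v) := by
  have hus := locallyIntegrable_comp_add hu (s • v)
  refine ae_eq_of_integral_contDiff_smul_eq (hus.sub hu)
    (locallyIntegrable_line_integral hw v s) fun g hg hgc => ?_
  have hgs : ∀ (f : E → ℂ), LocallyIntegrable f → Integrable fun ξ => g ξ • f ξ := fun f hf =>
    hf.integrable_smul_left_of_hasCompactSupport hg.continuous hgc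
  set μ := volume.restrict (Set.Ioc 0 s)
  have hdc : Continuous fun ξ => fderiv ℝ g ξ v :=
    (hg.continuous_fderiv (by simp)).clm_apply continuous_const
  have hdcs : HasCompactSupport fun ξ => fderiv ℝ g ξ v :=
    (hgc.fderiv (𝕜 := ℝ)).comp_left (g := fun L : E →L[ℝ] ℝ => L v) rfl
  -- Translation invariance moves the difference onto the smooth `g`, where it is an integral of
  -- directional derivatives. After Fubini, the hypothesis is applied to each translate of `g`.
  calc ∫ ξ, g ξ • (u (ξ + s • v) - u ξ)
      = ∫ ξ, (g (ξ - s • v) - g ξ) • u ξ := by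
        have e1 : ∫ ξ, g ξ • u (ξ + s • v) = ∫ ξ, g (ξ - s • v) • u ξ := by
          rw [← integral_add_right_eq_self (fun ξ => g (ξ - s • v) • u ξ) (s • v)]
          simp
        simp only [smul_sub, sub_smul]
        rw [integral_sub (hgs _ hus) (hgs _ hu), integral_sub ?_ (hgs _ hu), e1]
        have := (hgs _ hus).comp_sub_right (s • v)
        simpa using this
    _ = ∫ ξ, ∫ r, -(fderiv ℝ g (ξ - r • v) v • u ξ) ∂μ := by
        congr 1; ext ξ
        have hd : ∀ r : ℝ, HasDerivAt (fun r : ℝ => g (ξ - r • v))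
            (-(fderiv ℝ g (ξ - r • v) v)) r := by
          intro r
          have h1 : HasDerivAt (fun r : ℝ => ξ - r • v) (-v) r := by
            simpa using ((hasDerivAt_id r).smul_const v).const_sub ξ
          have h2 := (hg.differentiable (by simp) (ξ - r • v)).hasFDerivAt.comp_hasDerivAt r h1
          simpa [Function.comp_def] using! h2
        have hci : IntervalIntegrable (fun r : ℝ => -(fderiv ℝ g (ξ - r • v) v)) volume 0 s := by
          apply Continuous.intervalIntegrable
          exact (hdc.comp (by fun_prop : Continuous fun r : ℝ => ξ - r • v)).neg
        have := intervalIntegral.integral_eq_sub_of_hasDerivAt (fun r _ => hd r) hci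
        rw [zero_smul, sub_zero, intervalIntegral.integral_of_le hs] at this
        rw [← this, ← integral_smul_const]
        simp only [neg_smul]
        rfl
    _ = ∫ r, ∫ ξ, -(fderiv ℝ g (ξ - r • v) v • u ξ) ∂volume ∂μ := by
        apply integral_integral_swap
        have h1 := (integrable_smul_shear hu hdc hdcs v s).neg
        have hm : MeasurePreserving (fun p : E × ℝ => (p.1 - p.2 • v, p.2)) (volume.prod μ)
            (volume.prod μ) := by
          have h : MeasurePreserving (fun p : ℝ × E => (p.1, p.2 - p.1 • v)) (μ.prod volume)
              (μ.prod volume) :=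
            (MeasurePreserving.id μ).skew_product (g := fun r ξ => ξ - r • v) (by fun_prop)
              (Eventually.of_forall fun r => (measurePreserving_sub_right volume (r • v)).map_eq)
          exact (Measure.measurePreserving_swap.comp h).comp Measure.measurePreserving_swap
        have := hm.integrable_comp_of_integrable h1
        refine this.congr (Eventually.of_forall fun p => ?_)
        simp [Function.uncurry]
    _ = ∫ r, ∫ ξ, g ξ • w (ξ + r • v) ∂volume ∂μ := by
        congr 1; ext r
        have hgr : ContDiff ℝ ∞ fun ξ => g (ξ - r • v) := hg.comp (contDiff_id.sub contDiff_const)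
        have hgrc : HasCompactSupport fun ξ => g (ξ - r • v) :=
          hgc.comp_homeomorph (Homeomorph.subRight (r • v))
        have := h _ hgr hgrc
        have e : ∀ ξ, fderiv ℝ (fun ξ => g (ξ - r • v)) ξ = fderiv ℝ g (ξ - r • v) := fun ξ =>
          fderiv_comp_sub (f := g) (r • v)
        simp only [e] at this
        rw [integral_neg, this, neg_neg]
        rw [← integral_add_right_eq_self (fun ξ => g (ξ - r • v) • w ξ) (r • v)]
        simp
    _ = ∫ ξ, ∫ r, g ξ • w (ξ + r • v) ∂μ := by
        symm
        apply integral_integral_swap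
        exact integrable_smul_shear hw hg.continuous hgc v s
    _ = ∫ ξ, g ξ • ∫ r, w (ξ + r • v) ∂μ := by
        congr 1; ext ξ; rw [integral_smul]

/-- On almost every line `u` agrees almost everywhere with a primitive of `w`, to which
`norm_sq_primitive` applies. -/
theorem ae_norm_sq_eq_line_integral {u w : E → ℂ} (hum : Measurable u) (hwm : Measurable w)
    (hu : LocallyIntegrable u) (hw : LocallyIntegrable w)
    {v : E} (h : ∀ g : E → ℝ, ContDiff ℝ ∞ g → HasCompactSupport g →
      ∫ ξ, (fderiv ℝ g ξ v) • u ξ = - ∫ ξ, g ξ • w ξ) {s : ℝ} (hs : 0 ≤ s) :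
    ∀ᵐ ξ : E, ‖u (ξ + s • v)‖ ^ 2 - ‖u ξ‖ ^ 2
      = ∫ r in Set.Ioc 0 s, 2 * (conj (u (ξ + r • v)) * w (ξ + r • v)).re := by
  set μ := volume.restrict (Set.Ioc 0 s)
  -- Joint measurability is needed to exchange the two almost-everywhere quantifiers, as the
  -- exceptional set of `ξ` depends on the length `r`. The indicator turns the variable range of
  -- integration into a jointly measurable integrand.
  have hmeas : MeasurableSet {p : E × ℝ | u (p.1 + p.2 • v) - u p.1
      = ∫ q, (Set.Ioc 0 p.2).indicator (fun q => w (p.1 + q • v)) q} := by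
    apply measurableSet_eq_fun (by fun_prop)
    apply StronglyMeasurable.measurable
    apply StronglyMeasurable.integral_prod_right
    apply Measurable.stronglyMeasurable
    have : (Function.uncurry fun (p : E × ℝ) (q : ℝ) =>
        (Set.Ioc 0 p.2).indicator (fun q => w (p.1 + q • v)) q)
        = {z : (E × ℝ) × ℝ | 0 < z.2 ∧ z.2 ≤ z.1.2}.indicator (fun z => w (z.1.1 + z.2 • v)) := by
      ext ⟨p, q⟩
      simp [Function.uncurry, Set.indicator]
    rw [this]
    refine Measurable.indicator (by fun_prop) ?_
    exact (measurableSet_lt measurable_const measurable_snd).inter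
      (measurableSet_le measurable_snd (measurable_snd.comp measurable_fst))
  have hall : ∀ᵐ ξ : E, ∀ᵐ r ∂μ, u (ξ + r • v) - u ξ = ∫ q in Set.Ioc 0 r, w (ξ + q • v) := by
    have h1 : ∀ᵐ r ∂μ, ∀ᵐ ξ : E, u (ξ + r • v) - u ξ
        = ∫ q, (Set.Ioc 0 r).indicator (fun q => w (ξ + q • v)) q := by
      filter_upwards [ae_restrict_mem measurableSet_Ioc] with r hr
      filter_upwards [ae_eq_line_integral hu hw h hr.1.le] with ξ hξ
      rw [hξ, integral_indicator measurableSet_Ioc]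
    have h2 := (Measure.ae_ae_comm (p := fun ξ r => u (ξ + r • v) - u ξ
        = ∫ q, (Set.Ioc 0 r).indicator (fun q => w (ξ + q • v)) q) hmeas).2 h1
    simpa only [integral_indicator measurableSet_Ioc] using h2
  filter_upwards [hall, ae_eq_line_integral hu hw h hs, ae_integrable_line hw v s] with ξ h1 h2 h3
  have hi : IntervalIntegrable (fun r : ℝ => w (ξ + r • v)) volume 0 s :=
    (intervalIntegrable_iff_integrableOn_Ioc_of_le hs).2 h3
  have key := norm_sq_primitive hi (u ξ)
  rw [intervalIntegral.integral_of_le hs, intervalIntegral.integral_of_le hs, ← h2,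
    add_sub_cancel] at key
  rw [key]
  apply integral_congr_ae
  filter_upwards [h1, ae_restrict_mem measurableSet_Ioc] with r hr hr'
  rw [intervalIntegral.integral_of_le hr'.1.le, ← hr, add_sub_cancel]

/-! ### Fourier analysis of stationary densities -/

theorem fourier_eq_integral_exp (f : E → ℂ) (x : E) :
    𝓕 f x = ∫ ξ, cexp (-(2 * Real.pi * I * (⟪ξ, x⟫_ℝ : ℝ))) * f ξ := by
  rw [Real.fourier_eq']
  congr 1; ext ξ
  rw [smul_eq_mul]
  congr 2
  push_cast; ring

theorem integrable_exp_mul {f : E → ℂ} (hf : Integrable f) (x : E) :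
    Integrable fun ξ => cexp (-(2 * Real.pi * I * (⟪ξ, x⟫_ℝ : ℝ))) * f ξ := by
  refine hf.bdd_mul (c := 1) (Continuous.aestronglyMeasurable (by fun_prop))
    (Eventually.of_forall fun ξ => ?_)
  rw [norm_exp]; simp

theorem integral_exp_mul_comp_add (f : E → ℂ) (x y : E) :
    ∫ ξ, cexp (-(2 * Real.pi * I * (⟪ξ, x⟫_ℝ : ℝ))) * f (ξ + y)
      = cexp (2 * Real.pi * I * (⟪y, x⟫_ℝ : ℝ)) * 𝓕 f x := by
  rw [fourier_eq_integral_exp, ← integral_const_mul, ← integral_add_right_eq_self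
    (fun ξ => cexp (2 * Real.pi * I * (⟪y, x⟫_ℝ : ℝ)) *
      (cexp (-(2 * Real.pi * I * (⟪ξ, x⟫_ℝ : ℝ))) * f ξ)) y]
  congr 1; ext ξ
  rw [← mul_assoc, ← Complex.exp_add]
  congr 2
  rw [inner_add_left]
  push_cast; ring

/-- Integrating a function along lines multiplies its Fourier transform by the difference quotient
of a character. -/
theorem fourier_eq_of_line_integral {P Q : E → ℂ} (hP : Integrable P) (hQ : Integrable Q) {v : E}
    (h : ∀ s : ℝ, 0 ≤ s → ∀ᵐ ξ : E, P (ξ + s • v) - P ξ = ∫ r in Set.Ioc 0 s, Q (ξ + r • v))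
    (x : E) : 2 * Real.pi * I * (⟪v, x⟫_ℝ : ℝ) * 𝓕 P x = 𝓕 Q x := by
  set θ : ℂ := 2 * Real.pi * I * (⟪v, x⟫_ℝ : ℝ)
  have hshift : ∀ (f : E → ℂ) (r : ℝ),
      ∫ ξ, cexp (-(2 * Real.pi * I * (⟪ξ, x⟫_ℝ : ℝ))) * f (ξ + r • v) = cexp (r * θ) * 𝓕 f x := by
    intro f r
    rw [integral_exp_mul_comp_add, real_inner_smul_left]
    congr 2
    push_cast [θ]; ring
  have key : ∀ s : ℝ, 0 ≤ s →
      (cexp (s * θ) - 1) * 𝓕 P x = ∫ r in (0 : ℝ)..s, cexp (r * θ) * 𝓕 Q x := by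
    intro s hs
    set μ := volume.restrict (Set.Ioc 0 s)
    calc (cexp (s * θ) - 1) * 𝓕 P x
        = ∫ ξ, cexp (-(2 * Real.pi * I * (⟪ξ, x⟫_ℝ : ℝ))) * (P (ξ + s • v) - P ξ) := by
          simp only [mul_sub]
          rw [integral_sub (integrable_exp_mul (hP.comp_add_right _) x) (integrable_exp_mul hP x), hshift,
            ← fourier_eq_integral_exp]
          ring
      _ = ∫ ξ, ∫ r, cexp (-(2 * Real.pi * I * (⟪ξ, x⟫_ℝ : ℝ))) * Q (ξ + r • v) ∂μ := by
          apply integral_congr_ae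
          filter_upwards [h s hs] with ξ hξ
          rw [hξ, integral_const_mul]
      _ = ∫ r, ∫ ξ, cexp (-(2 * Real.pi * I * (⟪ξ, x⟫_ℝ : ℝ))) * Q (ξ + r • v) ∂volume ∂μ := by
          apply integral_integral_swap
          refine (integrable_shear hQ v μ).bdd_mul (c := 1)
            (f := fun p : E × ℝ => cexp (-(2 * Real.pi * I * (⟪p.1, x⟫_ℝ : ℝ))))
            (Continuous.aestronglyMeasurable (by fun_prop))
            (Eventually.of_forall fun ξ => ?_)
          rw [norm_exp]; simp
      _ = _ := by
          simp only [hshift]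
          rw [intervalIntegral.integral_of_le hs]
  have hd1 : HasDerivWithinAt (fun s : ℝ => (cexp (s * θ) - 1) * 𝓕 P x) (θ * 𝓕 P x)
      (Set.Ici 0) 0 := by
    have h1 : HasDerivAt (fun s : ℝ => (s : ℂ) * θ) (1 * θ) (0 : ℝ) :=
      (HasDerivAt.ofReal_comp (hasDerivAt_id (0 : ℝ))).mul_const θ
    have h2 := ((h1.cexp.sub_const 1).mul_const (𝓕 P x)).hasDerivWithinAt (s := Set.Ici 0)
    simpa using h2
  have hc : Continuous fun r : ℝ => cexp (r * θ) * 𝓕 Q x := by fun_prop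
  have hd2 : HasDerivWithinAt (fun s : ℝ => ∫ r in (0 : ℝ)..s, cexp (r * θ) * 𝓕 Q x) (𝓕 Q x)
      (Set.Ici 0) 0 := by
    have := (hc.integral_hasStrictDerivAt 0 0).hasDerivAt.hasDerivWithinAt (s := Set.Ici (0 : ℝ))
    simpa using this
  -- Comparing right derivatives at `s = 0` avoids dividing by `θ`, which may vanish.
  have hd3 := hd2.congr (fun s hs => key s hs) (key 0 le_rfl)
  exact (uniqueDiffOn_Ici (0 : ℝ) 0 Set.self_mem_Ici).eq_deriv _ hd1 hd3

/-- A nontrivial compound Poisson process with drift has no invariant probability density. -/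
theorem jumps_and_drift_trivial {P Q : E → ℝ} (hP : Integrable P) (hpos : ∫ ξ, P ξ ≠ 0)
    {v : E} {K : ℕ} {d : Fin K → ℝ} (hd : ∀ k, 0 ≤ d k) {a : Fin K → E}
    (hQ : ∀ᵐ ξ, Q ξ = 2 * Real.pi * ∑ k, d k * (P (ξ - a k) - P ξ))
    (h : ∀ s : ℝ, 0 ≤ s → ∀ᵐ ξ : E, P (ξ + s • v) - P ξ = ∫ r in Set.Ioc 0 s, Q (ξ + r • v)) :
    v = 0 ∧ ∀ k, d k = 0 ∨ a k = 0 := by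
  have hPs : ∀ k, Integrable fun ξ => P (ξ - a k) := fun k => hP.comp_sub_right (a k)
  have hQi : Integrable Q := by
    have : Integrable fun ξ => 2 * Real.pi * ∑ k, d k * (P (ξ - a k) - P ξ) :=
      (integrable_finsetSum Finset.univ fun k _ => ((hPs k).sub hP).const_mul (d k)).const_mul _
    refine this.congr ?_
    filter_upwards [hQ] with ξ hξ
    exact hξ.symm
  have hF := fourier_eq_of_line_integral (P := fun ξ => (P ξ : ℂ)) (Q := fun ξ => (Q ξ : ℂ))
    hP.ofReal hQi.ofReal (v := v) (fun s hs => by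
      filter_upwards [h s hs] with ξ hξ
      rw [← ofReal_sub, hξ]
      exact integral_ofReal.symm)
  set G := 𝓕 (fun ξ => (P ξ : ℂ))
  have hG : Continuous G :=
    VectorFourier.fourierIntegral_continuous Real.continuous_fourierChar
      (innerSL ℝ).continuous₂ hP.ofReal
  have hG0 : G 0 ≠ 0 := by
    have : G 0 = ((∫ ξ, P ξ : ℝ) : ℂ) := by
      refine (fourier_eq_integral_exp _ _).trans ?_
      simpa using (integral_ofReal (f := P) (𝕜 := ℂ))
    rw [this]
    exact_mod_cast hpos
  have hFQ : ∀ x, 𝓕 (fun ξ => (Q ξ : ℂ)) x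
      = 2 * Real.pi * (∑ k, d k * (cexp (-(2 * Real.pi * I * (⟪a k, x⟫_ℝ : ℝ))) - 1)) * G x := by
    intro x
    set e : E → ℂ := fun ξ => cexp (-(2 * Real.pi * I * (⟪ξ, x⟫_ℝ : ℝ))) with he
    have hi1 : ∀ k, Integrable fun ξ => e ξ * (P (ξ - a k) : ℂ) := fun k =>
      integrable_exp_mul (hPs k).ofReal x
    have hi2 : Integrable fun ξ => e ξ * (P ξ : ℂ) := integrable_exp_mul hP.ofReal x
    have h1 : 𝓕 (fun ξ => (Q ξ : ℂ)) x = ∫ ξ, 2 * Real.pi * ∑ k, (d k : ℂ) *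
        (e ξ * (P (ξ - a k) : ℂ) - e ξ * (P ξ : ℂ)) := by
      rw [fourier_eq_integral_exp]
      apply integral_congr_ae
      filter_upwards [hQ] with ξ hξ
      rw [hξ]
      push_cast
      rw [mul_left_comm, Finset.mul_sum]
      congr 1
      refine Finset.sum_congr rfl fun k _ => ?_
      simp only [he]; ring
    have hi3 : ∀ k ∈ Finset.univ, Integrable fun ξ =>
        (d k : ℂ) * (e ξ * (P (ξ - a k) : ℂ) - e ξ * (P ξ : ℂ)) := fun k _ =>
      ((hi1 k).sub hi2).const_mul (d k : ℂ)
    rw [h1, integral_const_mul, integral_finsetSum _ hi3, mul_assoc (2 * Real.pi : ℂ),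
      Finset.sum_mul]
    congr 1
    refine Finset.sum_congr rfl fun k _ => ?_
    rw [integral_const_mul, integral_sub (hi1 k) hi2]
    have h2 := integral_exp_mul_comp_add (fun ξ => (P ξ : ℂ)) x (-a k)
    simp only [← sub_eq_add_neg] at h2
    simp only [he]
    rw [h2, ← fourier_eq_integral_exp, inner_neg_left]
    push_cast
    ring_nf
    rfl
  -- The transform of `P` is continuous and equals `∫ P ≠ 0` at the origin, so it cancels nearby.
  have hnear : ∀ᶠ x in 𝓝 (0 : E), I * (⟪v, x⟫_ℝ : ℝ)
      = ∑ k, d k * (cexp (-(2 * Real.pi * I * (⟪a k, x⟫_ℝ : ℝ))) - 1) := by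
    filter_upwards [hG.continuousAt.eventually_ne hG0] with x hx
    have e := hF x
    rw [hFQ x] at e
    have e1 := mul_right_cancel₀ hx e
    have e2 : (2 * Real.pi : ℂ) ≠ 0 := by
      exact_mod_cast Real.two_pi_pos.ne'
    apply mul_left_cancel₀ e2
    rw [← e1]; ring
  -- The drift symbol is purely imaginary, while the real parts of the jump symbols are all
  -- nonpositive; their sum vanishes only termwise.
  have hre : ∀ᶠ x in 𝓝 (0 : E), ∀ k, d k * (Real.cos (2 * Real.pi * ⟪a k, x⟫_ℝ) - 1) = 0 := by
    filter_upwards [hnear] with x hx k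
    have e := congrArg re hx
    have hre' : ∀ k, ((d k : ℂ) * (cexp (-(2 * Real.pi * I * (⟪a k, x⟫_ℝ : ℝ))) - 1)).re
        = d k * (Real.cos (2 * Real.pi * ⟪a k, x⟫_ℝ) - 1) := by
      intro k
      rw [re_ofReal_mul, sub_re, one_re, exp_re]
      simp
    rw [re_sum, Finset.sum_congr rfl fun k _ => hre' k] at e
    have e0 : (I * (⟪v, x⟫_ℝ : ℝ)).re = 0 := by simp
    rw [e0] at e
    exact (Finset.sum_eq_zero_iff_of_nonpos fun k _ => mul_nonpos_of_nonneg_of_nonpos (hd k)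
      (sub_nonpos.2 (Real.cos_le_one _))).1 e.symm k (Finset.mem_univ k)
  have hray : ∀ y : E, Tendsto (fun t : ℝ => t • y) (𝓝 0) (𝓝 (0 : E)) := by
    intro y
    have : Continuous fun t : ℝ => t • y := by fun_prop
    simpa using this.tendsto 0
  have hsmall : ∀ p : ℝ → Prop, (∀ᶠ t in 𝓝 0, p t) → ∃ t, 0 < t ∧ p t := by
    intro p hp
    obtain ⟨t, ht, ht'⟩ := ((hp.filter_mono nhdsWithin_le_nhds).and
      (self_mem_nhdsWithin : ∀ᶠ t in 𝓝[>] (0 : ℝ), t ∈ Set.Ioi 0)).exists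
    exact ⟨t, ht', ht⟩
  have hk : ∀ k, d k = 0 ∨ a k = 0 := by
    intro k
    by_contra! hcon
    have hc1 : Tendsto (fun t : ℝ => 2 * Real.pi * ⟪a k, t • a k⟫_ℝ) (𝓝 0) (𝓝 0) := by
      have : Continuous fun t : ℝ => 2 * Real.pi * ⟪a k, t • a k⟫_ℝ := by fun_prop
      simpa using this.tendsto 0
    -- For small `t > 0` the phase at `t • a k` is below a full turn, so cosine one would force it
    -- to be zero, whereas it is positive.
    obtain ⟨t, ht, h1, h2, h3⟩ := hsmall _ (((hray (a k)).eventually hre).and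
      ((hc1.eventually_const_lt (show -(2 * Real.pi) < 0 by linarith [Real.two_pi_pos])).and
        (hc1.eventually_lt_const Real.two_pi_pos)))
    have h4 : Real.cos (2 * Real.pi * ⟪a k, t • a k⟫_ℝ) = 1 := by
      have := (mul_eq_zero.1 (h1 k)).resolve_left hcon.1
      linarith
    have h5 := (Real.cos_eq_one_iff_of_lt_of_lt h2 h3).1 h4
    have h6 : 0 < ⟪a k, a k⟫_ℝ := real_inner_self_pos.2 hcon.2
    rw [real_inner_smul_right] at h5
    have := Real.pi_pos
    have : 0 < 2 * Real.pi * (t * ⟪a k, a k⟫_ℝ) := by positivity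
    linarith
  refine ⟨?_, hk⟩
  by_contra hv
  obtain ⟨t, ht, h1⟩ := hsmall _ ((hray v).eventually hnear)
  rw [Finset.sum_eq_zero fun k _ => by rcases hk k with h | h <;> simp [h]] at h1
  have h2 : ⟪v, t • v⟫_ℝ = 0 := by simpa using h1
  rw [real_inner_smul_right] at h2
  have := mul_pos ht (real_inner_self_pos.2 hv)
  linarith

end NoGo

namespace NoGo

open Complex ComplexConjugate

variable {N : ℕ}

/-! ### Multiplication operators -/

theorem coeFn_mulOp (g : Config N → ℂ) (ψ : (mulOp g).domain) :
    mulOp g ψ =ᵐ[volume] fun x => g x * (ψ : Wave N) x :=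
  MemLp.coeFn_toLp ψ.2

theorem mem_momOp_domain {hb : ℝ} {f : Config N → ℂ} {φ : Wave N} :
    φ ∈ (momOp hb f).domain ↔
      MemLp (fun ξ => f ((2 * Real.pi * hb) • ξ) * fourierL2 N φ ξ) 2 volume :=
  Iff.rfl

theorem fourierL2_momOp {hb : ℝ} {f : Config N → ℂ} (φ : (momOp hb f).domain) :
    fourierL2 N (momOp hb f φ) =ᵐ[volume]
      fun ξ => f ((2 * Real.pi * hb) • ξ) * fourierL2 N φ ξ := by
  have : fourierL2 N (momOp hb f φ)
      = mulOp (fun ξ => f ((2 * Real.pi * hb) • ξ)) ⟨fourierL2 N φ, φ.2⟩ :=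
    (fourierL2 N).apply_symm_apply _
  rw [this]
  exact coeFn_mulOp _ _

theorem inner_eq_integral {φ χ : Wave N} {f g : Config N → ℂ} (hf : φ =ᵐ[volume] f)
    (hg : χ =ᵐ[volume] g) : ⟪φ, χ⟫_ℂ = ∫ ξ, conj (f ξ) * g ξ := by
  rw [L2.inner_def]
  apply integral_congr_ae
  filter_upwards [hf, hg] with ξ h1 h2
  rw [h1, h2, RCLike.inner_apply, mul_comm]

theorem inner_eq_integral_fourier {φ χ : Wave N} {f g : Config N → ℂ}
    (hf : fourierL2 N φ =ᵐ[volume] f) (hg : fourierL2 N χ =ᵐ[volume] g) :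
    ⟪φ, χ⟫_ℂ = ∫ ξ, conj (f ξ) * g ξ := by
  rw [← (fourierL2 N).inner_map_map φ χ, inner_eq_integral hf hg]

theorem isScalar_mulOp {g : Config N → ℂ} {c : ℂ} (hg : ∀ᵐ x, g x = c) : IsScalar (mulOp g) c := by
  intro ψ
  have h : MemLp (fun x => g x * ψ x) 2 volume := by
    refine ((Lp.memLp ψ).const_mul c).ae_eq ?_
    filter_upwards [hg] with x hx
    rw [hx]
  refine ⟨h, Lp.ext ?_⟩
  refine (coeFn_mulOp g ⟨ψ, h⟩).trans ?_
  filter_upwards [hg, Lp.coeFn_smul c ψ] with x hx hx'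
  rw [hx, hx', Pi.smul_apply, smul_eq_mul]

theorem isScalar_momOp {hb : ℝ} {f : Config N → ℂ} {c : ℂ}
    (hf : ∀ᵐ ξ, f ((2 * Real.pi * hb) • ξ) = c) : IsScalar (momOp hb f) c := by
  intro φ
  obtain ⟨h, h'⟩ := isScalar_mulOp hf (fourierL2 N φ)
  refine ⟨h, (fourierL2 N).injective ?_⟩
  have : fourierL2 N (momOp hb f ⟨φ, h⟩)
      = mulOp (fun ξ => f ((2 * Real.pi * hb) • ξ)) ⟨fourierL2 N φ, h⟩ :=
    (fourierL2 N).apply_symm_apply _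
  rw [this, h', map_smul]

/-! ### Phase factors -/

theorem mem_mulOp_phase (κ : Config N) (ψ : Wave N) :
    ψ ∈ (mulOp fun x : Config N => cexp (-I * ((⟪κ, x⟫_ℝ : ℝ) : ℂ))).domain := by
  refine (Lp.memLp ψ).of_le (AEStronglyMeasurable.mul (Continuous.aestronglyMeasurable
    (by fun_prop)) (Lp.aestronglyMeasurable ψ)) (Eventually.of_forall fun x => ?_)
  rw [norm_mul, norm_exp]
  simp

theorem inner_mulOp_phase (κ : Config N) (a b : Wave N) :
    ⟪mulOp (fun x : Config N => cexp (-I * ((⟪κ, x⟫_ℝ : ℝ) : ℂ))) ⟨a, mem_mulOp_phase κ a⟩,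
      mulOp (fun x : Config N => cexp (-I * ((⟪κ, x⟫_ℝ : ℝ) : ℂ))) ⟨b, mem_mulOp_phase κ b⟩⟫_ℂ
      = ⟪a, b⟫_ℂ := by
  rw [inner_eq_integral (coeFn_mulOp _ _) (coeFn_mulOp _ _),
    inner_eq_integral (EventuallyEq.refl _ _) (EventuallyEq.refl _ _)]
  congr 1; ext x
  have : conj (cexp (-I * ((⟪κ, x⟫_ℝ : ℝ) : ℂ))) * cexp (-I * ((⟪κ, x⟫_ℝ : ℝ) : ℂ)) = 1 := by
    rw [← exp_conj, ← Complex.exp_add]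
    simp
  simp only [map_mul]
  linear_combination (conj (a x) * b x) * this

/-! ### Momentum-space test functions -/

/-- The wave function with a given smooth compactly supported momentum representation. -/
noncomputable def testWave (g : Config N → ℂ) (hg : ContDiff ℝ ∞ g) (hgc : HasCompactSupport g) : Wave N :=
  (𝓕⁻ (hgc.toSchwartzMap hg)).toLp 2

theorem fourierL2_symm_toLp (S : SchwartzMap (Config N) ℂ) :
    (fourierL2 N).symm (S.toLp 2) = (𝓕⁻ S).toLp 2 :=
  SchwartzMap.toLp_fourierInv_eq S

theorem fourierL2_toLp_inv (S : SchwartzMap (Config N) ℂ) :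
    fourierL2 N ((𝓕⁻ S).toLp 2) = S.toLp 2 := by
  rw [← fourierL2_symm_toLp, LinearIsometryEquiv.apply_symm_apply]

section test

variable {g : Config N → ℂ} (hg : ContDiff ℝ ∞ g) (hgc : HasCompactSupport g)

theorem fourierL2_testWave : fourierL2 N (testWave g hg hgc) =ᵐ[volume] g := by
  rw [testWave, fourierL2_toLp_inv]
  exact SchwartzMap.coeFn_toLp _ _ _

theorem isMomentumTest_testWave : IsMomentumTest (testWave g hg hgc) :=
  ⟨g, hg, hgc, fourierL2_testWave hg hgc⟩

theorem coeFn_testWave : testWave g hg hgc =ᵐ[volume] 𝓕⁻ g := by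
  refine (SchwartzMap.coeFn_toLp _ _ _).trans (Eventually.of_forall fun x => ?_)
  rw [SchwartzMap.fourierInv_coe]
  rfl

/-- Modulation in position is translation in momentum; the phase is moved onto the test function,
where the Fourier integral is explicit. -/
theorem inner_testWave_phase (κ : Config N) (η : Wave N) :
    ⟪testWave g hg hgc,
      mulOp (fun x : Config N => cexp (-I * ((⟪κ, x⟫_ℝ : ℝ) : ℂ))) ⟨η, mem_mulOp_phase κ η⟩⟫_ℂ
      = ∫ ξ, conj (g (ξ - (2 * Real.pi)⁻¹ • κ)) * fourierL2 N η ξ := by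
  set a : Config N := (2 * Real.pi)⁻¹ • κ
  have hg' : ContDiff ℝ ∞ fun ξ => g (ξ - a) := hg.comp (contDiff_id.sub contDiff_const)
  have hgc' : HasCompactSupport fun ξ => g (ξ - a) :=
    hgc.comp_homeomorph (Homeomorph.subRight a)
  rw [← inner_eq_integral_fourier (fourierL2_testWave hg' hgc') (EventuallyEq.refl _ _),
    inner_eq_integral (coeFn_testWave hg hgc) (coeFn_mulOp _ _),
    inner_eq_integral (coeFn_testWave hg' hgc') (EventuallyEq.refl _ _)]
  congr 1; ext x
  have h1 : 𝓕⁻ (fun ξ => g (ξ - a)) x = cexp (I * ((⟪κ, x⟫_ℝ : ℝ) : ℂ)) * 𝓕⁻ g x := by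
    rw [Real.fourierInv_eq', Real.fourierInv_eq', ← integral_const_mul,
      ← integral_add_right_eq_self _ a]
    congr 1; ext ξ
    rw [add_sub_cancel_right, smul_eq_mul, smul_eq_mul, ← mul_assoc, ← Complex.exp_add]
    congr 2
    rw [inner_add_left, real_inner_smul_left]
    have : (Real.pi : ℂ) ≠ 0 := by exact_mod_cast Real.pi_ne_zero
    push_cast
    field_simp
    ring
  rw [h1, map_mul, ← exp_conj]
  simp only [map_mul, conj_I, conj_ofReal]
  ring

/-- Position acts as a derivative in momentum. The test function is treated as a Schwartz function,
and the factor `I / (2π)` comes from the kernel `e^{-2πi ξ·x}`. -/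
theorem mulOp_inner_testWave (κ : Config N) :
    ∃ h : testWave g hg hgc ∈ (mulOp fun x : Config N => ((⟪κ, x⟫_ℝ : ℝ) : ℂ)).domain,
      fourierL2 N (mulOp _ ⟨testWave g hg hgc, h⟩) =ᵐ[volume]
        fun ξ => I / (2 * Real.pi) * fderiv ℝ g ξ κ := by
  set S := hgc.toSchwartzMap hg
  have hpi : (2 * Real.pi : ℂ) ≠ 0 := by exact_mod_cast Real.two_pi_pos.ne'
  have htg : (fun x : Config N => (⟪x, κ⟫_ℝ : ℝ)).HasTemperateGrowth := by fun_prop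
  obtain ⟨T, hT, hS⟩ : ∃ T : SchwartzMap (Config N) ℂ,
      (∀ ξ, T ξ = I / (2 * Real.pi) * fderiv ℝ g ξ κ) ∧
      ∀ x, ((⟪κ, x⟫_ℝ : ℝ) : ℂ) * (𝓕⁻ S) x = (𝓕⁻ T) x := by
    refine ⟨(I / (2 * Real.pi)) • LineDeriv.lineDerivOp κ S, fun ξ => ?_, fun x => ?_⟩
    · rw [_root_.smul_apply, SchwartzMap.lineDerivOp_apply_eq_fderiv, smul_eq_mul]
      rfl
    have e := congrArg (fun T : SchwartzMap (Config N) ℂ => T x)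
      (SchwartzMap.fourierInv_lineDerivOp_eq S κ)
    simp only [_root_.smul_apply, SchwartzMap.smulLeftCLM_apply_apply htg] at e
    rw [FourierTransform.fourierInv_smul, _root_.smul_apply, e, real_inner_comm]
    simp only [smul_eq_mul, real_smul]
    field_simp
    rw [I_sq]; ring
  obtain ⟨T', hT'⟩ : ∃ T' : SchwartzMap (Config N) ℂ, T' = 𝓕⁻ T := ⟨_, rfl⟩
  have hae : (fun x => ((⟪κ, x⟫_ℝ : ℝ) : ℂ) * testWave g hg hgc x) =ᵐ[volume] ⇑T' := by
    filter_upwards [SchwartzMap.coeFn_toLp (𝓕⁻ S) 2 (volume : Measure (Config N))] with x hx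
    rw [testWave, hx, hS, hT']
  have hmem : testWave g hg hgc ∈ (mulOp fun x : Config N => ((⟪κ, x⟫_ℝ : ℝ) : ℂ)).domain :=
    (T'.memLp 2 volume).ae_eq hae.symm
  refine ⟨hmem, ?_⟩
  have heq : mulOp (fun x : Config N => ((⟪κ, x⟫_ℝ : ℝ) : ℂ)) ⟨_, hmem⟩ = T'.toLp 2 volume := by
    apply Lp.ext
    have h1 := coeFn_mulOp (fun x : Config N => ((⟪κ, x⟫_ℝ : ℝ) : ℂ)) ⟨_, hmem⟩
    have h2 := SchwartzMap.coeFn_toLp T' 2 (volume : Measure (Config N))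
    exact (h1.trans hae).trans h2.symm
  rw [heq, hT', fourierL2_toLp_inv]
  exact (SchwartzMap.coeFn_toLp T 2 volume).trans (Eventually.of_forall hT)

end test

theorem contDiff_hasCompactSupport_ofReal {γ : Config N → ℝ} (hγ : ContDiff ℝ ∞ γ) (hγc : HasCompactSupport γ) :
    ContDiff ℝ ∞ (fun ξ => (γ ξ : ℂ)) ∧ HasCompactSupport (fun ξ => (γ ξ : ℂ)) :=
  ⟨ofRealCLM.contDiff.comp hγ, hγc.comp_left (g := ((↑) : ℝ → ℂ)) ofReal_zero⟩

/-- The wave function with a given real test function as its momentum representation. -/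
noncomputable def realTestWave (γ : Config N → ℝ) (hγ : ContDiff ℝ ∞ γ) (hγc : HasCompactSupport γ) : Wave N :=
  testWave _ (contDiff_hasCompactSupport_ofReal hγ hγc).1 (contDiff_hasCompactSupport_ofReal hγ hγc).2

theorem fourierL2_realTestWave {γ : Config N → ℝ} (hγ : ContDiff ℝ ∞ γ)
    (hγc : HasCompactSupport γ) :
    fourierL2 N (realTestWave γ hγ hγc) =ᵐ[volume] fun ξ => (γ ξ : ℂ) :=
  fourierL2_testWave _ _

theorem isMomentumTest_realTestWave {γ : Config N → ℝ} (hγ : ContDiff ℝ ∞ γ)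
    (hγc : HasCompactSupport γ) : IsMomentumTest (realTestWave γ hγ hγc) :=
  isMomentumTest_testWave _ _

theorem locallyIntegrable_of_test {w : Config N → ℂ}
    (h : ∀ γ : Config N → ℝ, ContDiff ℝ ∞ γ → HasCompactSupport γ →
      Integrable fun ξ => w ξ * γ ξ) : LocallyIntegrable w := by
  rw [locallyIntegrable_iff]
  intro K hK
  obtain ⟨γ, hγ, hγc, h1⟩ := exists_test_eq_one hK
  refine ((h γ hγ hγc).integrableOn (s := K)).congr ?_
  filter_upwards [ae_restrict_mem hK.measurableSet] with ξ hξ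
  simp [h1 ξ hξ]

theorem ae_eq_of_integral_test {w w' : Config N → ℂ}
    (hw : LocallyIntegrable w) (hw' : LocallyIntegrable w')
    (h : ∀ γ : Config N → ℝ, ContDiff ℝ ∞ γ → HasCompactSupport γ →
      ∫ ξ, w ξ * γ ξ = ∫ ξ, w' ξ * γ ξ) : w =ᵐ[volume] w' := by
  refine ae_eq_of_integral_contDiff_smul_eq hw hw' fun γ hγ hγc => ?_
  have := h γ hγ hγc
  simp only [real_smul, mul_comm] at this ⊢
  exact this

/-- A vector orthogonal to all tests has vanishing Fourier transform by the fundamental lemma of the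
calculus of variations. -/
theorem dense_of_test {T : Submodule ℂ (Wave N)} (h : ∀ φ, IsMomentumTest φ → φ ∈ T) :
    Dense (T : Set (Wave N)) := by
  rw [Submodule.dense_iff_topologicalClosure_eq_top, Submodule.topologicalClosure_eq_top_iff,
    Submodule.eq_bot_iff]
  intro η hη
  have h0 : fourierL2 N η =ᵐ[volume] (0 : Config N → ℂ) := by
    have hloc : LocallyIntegrable (fun ξ => conj (fourierL2 N η ξ)) :=
      ((Lp.memLp (fourierL2 N η)).star).locallyIntegrable (by norm_num)
    have := ae_eq_of_integral_test hloc (w' := 0) (locallyIntegrable_zero)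
      (fun γ hγ hγc => by
        have e := (Submodule.mem_orthogonal' _ _).1 hη (realTestWave γ hγ hγc)
          (h _ (isMomentumTest_realTestWave hγ hγc))
        rw [inner_eq_integral_fourier (EventuallyEq.refl _ _)
            (fourierL2_realTestWave hγ hγc)] at e
        rw [e]; simp)
    filter_upwards [this] with ξ hξ
    simpa using hξ
  apply (fourierL2 N).injective
  rw [map_zero]
  exact Lp.ext (h0.trans (Lp.coeFn_zero _ _ _).symm)

end NoGo

namespace NoGo

open Complex ComplexConjugate

/-! ### Relaxation operators on momentum-space test functions -/

namespace TransInvRelaxation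

variable {N K : ℕ} (R : TransInvRelaxation N K) (hb : ℝ)

/-- The function `fₖ(p)` in the variable `ξ = p / (2πħ)`. -/
noncomputable def symbol (k : Fin K) (ξ : Config N) : ℂ := R.f k ((2 * Real.pi * hb) • ξ)

/-- The function `f_aux(p)` in the variable `ξ = p / (2πħ)`. -/
noncomputable def auxSymbol (ξ : Config N) : ℝ := R.faux ((2 * Real.pi * hb) • ξ)

/-- The momentum kick `ħκₖ` in the variable `ξ = p / (2πħ)`. -/
noncomputable def kick (k : Fin K) : Config N := (2 * Real.pi)⁻¹ • R.κ k

theorem measurable_symbol (k : Fin K) : Measurable (R.symbol hb k) :=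
  (R.measurable_f k).comp (measurable_const_smul _)

theorem measurable_auxSymbol : Measurable (R.auxSymbol hb) :=
  R.measurable_faux.comp (measurable_const_smul _)

variable {R hb} {k : Fin K}

theorem A_apply {φ : Wave N} (h : φ ∈ (R.A hb k).domain) :
    ∃ h' : φ ∈ (momOp hb (R.f k)).domain,
      R.A hb k ⟨φ, h⟩ = mulOp (fun x : Config N => cexp (-I * ((⟪R.κ k, x⟫_ℝ : ℝ) : ℂ)))
        ⟨momOp hb (R.f k) ⟨φ, h'⟩, mem_mulOp_phase _ _⟩ := by
  obtain ⟨h1, h2, h3⟩ := exists_of_mem_opMul h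
  exact ⟨h1, h3⟩

section dissipator

variable (hdom : ∀ φ, IsMomentumTest φ → φ ∈ dissDomain (R.A hb k))
include hdom

theorem test_mem_A_domain {φ : Wave N} (hφ : IsMomentumTest φ) : φ ∈ (R.A hb k).domain :=
  (exists_of_mem_opMul (hdom φ hφ).2).1

theorem dense_A_domain : Dense ((R.A hb k).domain : Set (Wave N)) :=
  dense_of_test fun _ hφ => test_mem_A_domain hdom hφ

theorem memLp_symbol_mul_test {γ : Config N → ℝ} (hγ : ContDiff ℝ ∞ γ)
    (hγc : HasCompactSupport γ) : MemLp (fun ξ => R.symbol hb k ξ * γ ξ) 2 volume := by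
  obtain ⟨h, -⟩ := A_apply (test_mem_A_domain hdom (isMomentumTest_realTestWave hγ hγc))
  refine MemLp.ae_eq ?_ (mem_momOp_domain.1 h)
  filter_upwards [fourierL2_realTestWave hγ hγc] with ξ hξ
  rw [hξ]; rfl

/-- The abstract adjoint is identified by pairing it with all test functions, which lie in the
domain of `A`; the phase factor becomes the momentum kick. -/
theorem fourierL2_adjoint_A {γ : Config N → ℝ} (hγ : ContDiff ℝ ∞ γ) (hγc : HasCompactSupport γ)
    (h : realTestWave γ hγ hγc ∈ (R.A hb k)†.domain) :
    fourierL2 N ((R.A hb k)† ⟨_, h⟩) =ᵐ[volume]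
      fun ξ => conj (R.symbol hb k ξ) * γ (ξ - R.kick k) := by
  have hγ' : ContDiff ℝ ∞ fun ξ => γ (ξ - R.kick k) := hγ.comp (contDiff_id.sub contDiff_const)
  have hγc' : HasCompactSupport fun ξ => γ (ξ - R.kick k) :=
    hγc.comp_homeomorph (Homeomorph.subRight (R.kick k))
  have h1 : (fun ξ => conj (fourierL2 N ((R.A hb k)† ⟨_, h⟩) ξ)) =ᵐ[volume]
      fun ξ => R.symbol hb k ξ * γ (ξ - R.kick k) := by
    refine ae_eq_of_integral_test ((Lp.memLp _).star.locallyIntegrable (by norm_num))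
      ((memLp_symbol_mul_test hdom hγ' hγc').locallyIntegrable (by norm_num))
      fun η hη hηc => ?_
    have hχ := test_mem_A_domain hdom (isMomentumTest_realTestWave hη hηc)
    have e := LinearPMap.adjoint_isFormalAdjoint (dense_A_domain hdom) ⟨_, h⟩ ⟨_, hχ⟩
    rw [inner_eq_integral_fourier (EventuallyEq.refl _ _) (fourierL2_realTestWave hη hηc)] at e
    rw [e]
    obtain ⟨h', h''⟩ := A_apply hχ
    rw [h'']
    refine (inner_testWave_phase _ _ _ _).trans ?_
    apply integral_congr_ae
    filter_upwards [fourierL2_momOp ⟨_, h'⟩, fourierL2_realTestWave hη hηc] with ξ h2 h3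
    rw [h2, h3, conj_ofReal]
    simp only [symbol, kick]
    ring
  filter_upwards [h1] with ξ hξ
  have := congrArg conj hξ
  rw [conj_conj] at this
  rw [this, map_mul, conj_ofReal]

/-- The phase is an isometry and cancels in `⟨Aφ, Aχ⟩`, so only the squared modulus of the symbol
remains. -/
theorem fourierL2_adjoint_mul_A {γ : Config N → ℝ} (hγ : ContDiff ℝ ∞ γ)
    (hγc : HasCompactSupport γ)
    (h : realTestWave γ hγ hγc ∈ (opMul (R.A hb k)† (R.A hb k)).domain) :
    fourierL2 N (opMul (R.A hb k)† (R.A hb k) ⟨_, h⟩) =ᵐ[volume]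
      fun ξ => ((‖R.symbol hb k ξ‖ ^ 2 : ℝ) : ℂ) * γ ξ := by
  have h1 : (fun ξ => conj (fourierL2 N (opMul (R.A hb k)† (R.A hb k) ⟨_, h⟩) ξ)) =ᵐ[volume]
      fun ξ => ((‖R.symbol hb k ξ‖ ^ 2 : ℝ) : ℂ) * γ ξ := by
    have hnorm : ∀ ξ, ((‖R.symbol hb k ξ‖ ^ 2 : ℝ) : ℂ)
        = conj (R.symbol hb k ξ) * R.symbol hb k ξ := fun ξ => by
      rw [conj_mul', ofReal_pow]
    have hloc : LocallyIntegrable fun ξ => ((‖R.symbol hb k ξ‖ ^ 2 : ℝ) : ℂ) * γ ξ := by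
      refine locallyIntegrable_of_test fun η hη hηc => ?_
      refine ((memLp_symbol_mul_test hdom hγ hγc).star.integrable_mul
        (memLp_symbol_mul_test hdom hη hηc)).congr (Eventually.of_forall fun ξ => ?_)
      simp only [Pi.mul_apply, Pi.star_apply, hnorm, star_mul', RCLike.star_def, conj_ofReal]
      ring
    refine ae_eq_of_integral_test ((Lp.memLp _).star.locallyIntegrable (by norm_num)) hloc
      fun η hη hηc => ?_
    have hχ := test_mem_A_domain hdom (isMomentumTest_realTestWave hη hηc)
    obtain ⟨g1, g2, g3⟩ := exists_of_mem_opMul h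
    have e := LinearPMap.adjoint_isFormalAdjoint (dense_A_domain hdom) ⟨_, g2⟩ ⟨_, hχ⟩
    rw [← g3, inner_eq_integral_fourier (EventuallyEq.refl _ _)
      (fourierL2_realTestWave hη hηc)] at e
    rw [e]
    obtain ⟨h', h''⟩ := A_apply hχ
    obtain ⟨k', k''⟩ := A_apply g1
    simp only [k'', h'']
    rw [inner_mulOp_phase, inner_eq_integral_fourier (fourierL2_momOp _) (fourierL2_momOp _)]
    apply integral_congr_ae
    filter_upwards [fourierL2_realTestWave hη hηc, fourierL2_realTestWave hγ hγc] with ξ h2 h3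
    simp only [hnorm, h2, h3, map_mul, conj_ofReal]
    simp only [symbol]
    ring
  filter_upwards [h1] with ξ hξ
  have := congrArg conj hξ
  rw [conj_conj] at this
  rw [this, map_mul, conj_ofReal, conj_ofReal]

end dissipator

theorem fourierL2_drift {γ : Config N → ℝ} (hγ : ContDiff ℝ ∞ γ) (hγc : HasCompactSupport γ)
    (h : realTestWave γ hγ hγc ∈ (R.drift hb).domain) :
    fourierL2 N (R.drift hb ⟨_, h⟩) =ᵐ[volume]
      fun ξ => I / (2 * Real.pi) * (fderiv ℝ γ ξ R.κaux : ℝ) + R.auxSymbol hb ξ * γ ξ := by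
  obtain ⟨h1, h2⟩ := mulOp_inner_testWave (contDiff_hasCompactSupport_ofReal hγ hγc).1
    (contDiff_hasCompactSupport_ofReal hγ hγc).2 R.κaux
  have e : R.drift hb ⟨_, h⟩ = mulOp (fun x : Config N => ((⟪R.κaux, x⟫_ℝ : ℝ) : ℂ)) ⟨_, h1⟩
      + momOp hb (fun p => (R.faux p : ℂ)) ⟨_, h.2⟩ := rfl
  rw [e, map_add]
  refine (Lp.coeFn_add _ _).trans ?_
  filter_upwards [h2, fourierL2_momOp ⟨_, h.2⟩, fourierL2_realTestWave hγ hγc] with ξ h3 h4 h5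
  rw [Pi.add_apply, h3, h4, h5]
  congr 2
  have hd : HasFDerivAt (fun ξ => (γ ξ : ℂ)) (ofRealCLM.comp (fderiv ℝ γ ξ)) ξ :=
    ofRealCLM.hasFDerivAt.comp ξ (hγ.differentiable (by simp) ξ).hasFDerivAt
  rw [hd.fderiv]
  rfl

theorem memLp_auxSymbol_mul_test {γ : Config N → ℝ} (hγ : ContDiff ℝ ∞ γ)
    (hγc : HasCompactSupport γ) (h : realTestWave γ hγ hγc ∈ (R.drift hb).domain) :
    MemLp (fun ξ => (R.auxSymbol hb ξ : ℂ) * γ ξ) 2 volume := by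
  refine MemLp.ae_eq ?_ (mem_momOp_domain.1 h.2)
  filter_upwards [fourierL2_realTestWave hγ hγc] with ξ hξ
  rw [hξ]; rfl

end TransInvRelaxation

/-- The momentum-space test functions form a subspace. -/
noncomputable def momentumTests (N : ℕ) : Submodule ℂ (Wave N) where
  carrier := {φ | IsMomentumTest φ}
  zero_mem' := ⟨0, contDiff_const, HasCompactSupport.zero, by
    rw [map_zero]; exact Lp.coeFn_zero _ _ _⟩
  add_mem' := by
    rintro a b ⟨g, hg, hgc, h⟩ ⟨g', hg', hgc', h'⟩
    refine ⟨g + g', hg.add hg', hgc.add hgc', ?_⟩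
    rw [map_add]
    exact (Lp.coeFn_add _ _).trans (h.add h')
  smul_mem' := by
    rintro c a ⟨g, hg, hgc, h⟩
    refine ⟨c • g, contDiff_const.smul hg, hgc.smul_left, ?_⟩
    rw [map_smul]
    exact (Lp.coeFn_smul _ _).trans (h.const_smul c)

end NoGo

namespace NoGo

open Complex ComplexConjugate

/-! ### Stationary pure states of the relaxation -/

theorem inner_pureState {N : ℕ} (Ψ x y : Wave N) :
    ⟪x, pureState Ψ y⟫_ℂ = conj ⟪Ψ, x⟫_ℂ * ⟪Ψ, y⟫_ℂ := by
  rw [pureState, InnerProductSpace.rankOne_apply, inner_smul_right, inner_conj_symm, mul_comm]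

namespace TransInvRelaxation

variable {N K : ℕ} {R : TransInvRelaxation N K} {hb : ℝ}

/-- For a rank-one state every term factorizes. Collecting loss and drift into one functional gives
the shape required by `functionals_proportional`. -/
theorem relForm_pureState {Ψ φ χ : Wave N} (hφ : φ ∈ R.relDomain hb) (hχ : χ ∈ R.relDomain hb) :
    R.relForm hb (pureState Ψ) φ χ hφ hχ =
      ∑ k, conj ⟪Ψ, (R.A hb k)† ⟨φ, (R.relDomain_diss hb hφ k).1⟩⟫_ℂ
          * ⟪Ψ, (R.A hb k)† ⟨χ, (R.relDomain_diss hb hχ k).1⟩⟫_ℂ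
        - (conj ((1 / 2) * ∑ k, ⟪Ψ, opMul (R.A hb k)† (R.A hb k)
              ⟨φ, (R.relDomain_diss hb hφ k).2⟩⟫_ℂ - I * ⟪Ψ, R.drift hb ⟨φ, hφ.2⟩⟫_ℂ) * ⟪Ψ, χ⟫_ℂ
          + conj ⟪Ψ, φ⟫_ℂ * ((1 / 2) * ∑ k, ⟪Ψ, opMul (R.A hb k)† (R.A hb k)
              ⟨χ, (R.relDomain_diss hb hχ k).2⟩⟫_ℂ - I * ⟪Ψ, R.drift hb ⟨χ, hχ.2⟩⟫_ℂ)) := by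
  have hd : ∀ k, dissForm (R.A hb k) (pureState Ψ) φ χ (R.relDomain_diss hb hφ k)
      (R.relDomain_diss hb hχ k) =
      conj ⟪Ψ, (R.A hb k)† ⟨φ, (R.relDomain_diss hb hφ k).1⟩⟫_ℂ
          * ⟪Ψ, (R.A hb k)† ⟨χ, (R.relDomain_diss hb hχ k).1⟩⟫_ℂ
        - (1 / 2) * (conj ⟪Ψ, opMul (R.A hb k)† (R.A hb k)
              ⟨φ, (R.relDomain_diss hb hφ k).2⟩⟫_ℂ * ⟪Ψ, χ⟫_ℂ
          + conj ⟪Ψ, φ⟫_ℂ * ⟪Ψ, opMul (R.A hb k)† (R.A hb k)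
              ⟨χ, (R.relDomain_diss hb hχ k).2⟩⟫_ℂ) := fun k => by
    simp only [dissForm, inner_pureState]
  rw [relForm, Finset.sum_congr rfl fun k _ => hd k]
  simp only [commForm, inner_pureState, Finset.sum_sub_distrib, ← Finset.mul_sum, Finset.sum_add_distrib,
    ← Finset.sum_mul, map_sub, map_mul, map_sum, conj_I, map_div₀, map_one, map_ofNat]
  ring

/-- Stationarity, read on test functions, equates two sesquilinear forms built from functionals. The
conclusion is the weak form of the eigenvalue equations for `Ψ`, which need not lie in the domains
of the operators. -/
theorem exists_eigenvalues {Ψ : Wave N} (hΨ : Ψ ≠ 0)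
    (hdom : ∀ φ, IsMomentumTest φ → φ ∈ R.relDomain hb)
    (hzero : ∀ φ χ (hφ : IsMomentumTest φ) (hχ : IsMomentumTest χ),
      R.relForm hb (pureState Ψ) φ χ (hdom φ hφ) (hdom χ hχ) = 0) :
    ∃ (c : Fin K → ℂ) (z : ℂ), 2 * z.re = ∑ k, ‖c k‖ ^ 2 ∧
      (∀ φ (hφ : φ ∈ R.relDomain hb), IsMomentumTest φ →
        (∀ k, ⟪Ψ, (R.A hb k)† ⟨φ, (R.relDomain_diss hb hφ k).1⟩⟫_ℂ = c k * ⟪Ψ, φ⟫_ℂ) ∧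
        (1 / 2) * ∑ k, ⟪Ψ, opMul (R.A hb k)† (R.A hb k) ⟨φ, (R.relDomain_diss hb hφ k).2⟩⟫_ℂ
          - I * ⟪Ψ, R.drift hb ⟨φ, hφ.2⟩⟫_ℂ = z * ⟪Ψ, φ⟫_ℂ) := by
  set T := momentumTests N
  have h1 : ∀ k, T ≤ ((R.A hb k)†).domain := fun k φ hφ => (R.relDomain_diss hb (hdom φ hφ) k).1
  have h2 : ∀ k, T ≤ (opMul (R.A hb k)† (R.A hb k)).domain := fun k φ hφ =>
    (R.relDomain_diss hb (hdom φ hφ) k).2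
  have h3 : T ≤ (R.drift hb).domain := fun φ hφ => (hdom φ hφ).2
  let ℓ : Fin K → T →ₗ[ℂ] ℂ := fun k =>
    (innerₛₗ ℂ Ψ) ∘ₗ ((R.A hb k)†).toFun ∘ₗ Submodule.inclusion (h1 k)
  let w : T →ₗ[ℂ] ℂ := (1 / 2 : ℂ) • ∑ k,
      (innerₛₗ ℂ Ψ) ∘ₗ (opMul (R.A hb k)† (R.A hb k)).toFun ∘ₗ Submodule.inclusion (h2 k)
    - I • (innerₛₗ ℂ Ψ) ∘ₗ (R.drift hb).toFun ∘ₗ Submodule.inclusion h3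
  let ℓ₀ : T →ₗ[ℂ] ℂ := (innerₛₗ ℂ Ψ) ∘ₗ T.subtype
  have hw : ∀ (φ : Wave N) (hφ : φ ∈ R.relDomain hb) (hT : φ ∈ T), w ⟨φ, hT⟩ =
      (1 / 2) * ∑ k, ⟪Ψ, opMul (R.A hb k)† (R.A hb k) ⟨φ, (R.relDomain_diss hb hφ k).2⟩⟫_ℂ
          - I * ⟪Ψ, R.drift hb ⟨φ, hφ.2⟩⟫_ℂ := by
    intro φ hφ hT
    simp only [w, LinearMap.sub_apply, LinearMap.smul_apply, LinearMap.sum_apply, smul_eq_mul]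
    rfl
  have hne : ∃ χ₀ : T, ℓ₀ χ₀ ≠ 0 := by
    by_contra! hcon
    apply hΨ
    have hd : Dense (T : Set (Wave N)) := dense_of_test fun φ hφ => hφ
    exact hd.eq_zero_of_inner_left ℂ fun v hv => hcon ⟨v, hv⟩
  obtain ⟨χ₀, hχ₀⟩ := hne
  obtain ⟨c, z, hc, hz, hre⟩ := functionals_proportional ℓ ℓ₀ w (fun φ χ => by
    have e := hzero φ χ φ.2 χ.2
    rw [relForm_pureState, sub_eq_zero, ← hw φ (hdom φ φ.2) φ.2,
      ← hw χ (hdom χ χ.2) χ.2] at e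
    exact e) hχ₀
  refine ⟨c, z, hre, fun φ hφ hT => ⟨fun k => hc k ⟨φ, hT⟩, ?_⟩⟩
  rw [← hw φ hφ hT]
  exact hz ⟨φ, hT⟩

/-- If `|Ψ⟩⟨Ψ|` is stationary under a translation-invariant relaxation, with `Ψ` nonvanishing in
momentum space, then the relaxation operators are multiples of the identity. -/
theorem isScalar_of_stationary {Ψ : Wave N} (hΨ : Ψ ≠ 0) (hne : ∀ᵐ ξ, fourierL2 N Ψ ξ ≠ 0)
    (hdom : ∀ φ, IsMomentumTest φ → φ ∈ R.relDomain hb)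
    (hzero : ∀ φ χ (hφ : IsMomentumTest φ) (hχ : IsMomentumTest χ),
      R.relForm hb (pureState Ψ) φ χ (hdom φ hφ) (hdom χ hχ) = 0) :
    (∀ k, ∃ c : ℂ, IsScalar (R.A hb k) c) ∧ ∃ r : ℝ, IsScalar (R.drift hb) r := by
  obtain ⟨c, z, hz, h⟩ := exists_eigenvalues hΨ hdom hzero
  have hdiss : ∀ k φ, IsMomentumTest φ → φ ∈ dissDomain (R.A hb k) := fun k φ hφ =>
    R.relDomain_diss hb (hdom φ hφ) k
  set ψ : Config N → ℂ := fun ξ => fourierL2 N Ψ ξ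
  have hψm : Measurable ψ := (Lp.stronglyMeasurable _).measurable
  set u : Config N → ℂ := fun ξ => conj (ψ ξ) with hudef
  have hum : Measurable u := continuous_conj.measurable.comp hψm
  have hu2 : MemLp u 2 volume := (Lp.memLp (fourierL2 N Ψ)).star
  have hul : LocallyIntegrable u := hu2.locallyIntegrable (by norm_num)
  have huΨ : ∀ {φ : Wave N} {g : Config N → ℂ}, fourierL2 N φ =ᵐ[volume] g →
      ⟪Ψ, φ⟫_ℂ = ∫ ξ, u ξ * g ξ := fun hg => inner_eq_integral_fourier (EventuallyEq.refl _ _) hg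
  have htest2 : ∀ {γ : Config N → ℝ}, ContDiff ℝ ∞ γ → HasCompactSupport γ →
      MemLp (fun ξ => (γ ξ : ℂ)) 2 volume := fun hγ hγc =>
    (contDiff_hasCompactSupport_ofReal hγ hγc).1.continuous.memLp_of_hasCompactSupport
      (contDiff_hasCompactSupport_ofReal hγ hγc).2
  -- `Ψ` is an eigenvector of the jump operators
  have hjump : ∀ k, ∀ᵐ ξ, conj (R.symbol hb k ξ) * u ξ = c k * u (ξ - R.kick k) := by
    intro k
    set a := R.kick k
    set B : Config N → ℂ := fun ξ => conj (R.symbol hb k (ξ + a)) * u (ξ + a)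
    -- The adjoint carries the shift on `γ`; recentring by the kick lets an unshifted `γ` test the
    -- identity.
    have hshift : ∀ γ : Config N → ℝ, (fun ξ => B ξ * γ ξ)
        = fun ξ => (fun η => u η * (conj (R.symbol hb k η) * γ (η - a))) (ξ + a) := fun γ => by
      ext ξ
      simp only [B, add_sub_cancel_right]
      ring
    have hBl : LocallyIntegrable B := by
      refine locallyIntegrable_of_test fun γ hγ hγc => ?_
      have hφ := R.relDomain_diss hb (hdom _ (isMomentumTest_realTestWave hγ hγc)) k
      have h2 := (Lp.memLp _).ae_eq (fourierL2_adjoint_A (hdiss k) hγ hγc hφ.1)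
      rw [hshift]
      exact (hu2.integrable_mul h2).comp_add_right a
    have hB : B =ᵐ[volume] fun ξ => c k * u ξ := by
      refine ae_eq_of_integral_test hBl (hul.smul (c k)) fun γ hγ hγc => ?_
      have hT := isMomentumTest_realTestWave hγ hγc
      have e := (h _ (hdom _ hT) hT).1 k
      rw [huΨ (fourierL2_adjoint_A (hdiss k) hγ hγc _), huΨ (fourierL2_realTestWave hγ hγc),
        ← integral_const_mul] at e
      rw [hshift, integral_add_right_eq_self
        (fun η => u η * (conj (R.symbol hb k η) * γ (η - a))), e]
      congr 1; ext ξ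
      rw [mul_assoc]
    filter_upwards [(measurePreserving_sub_right volume a).quasiMeasurePreserving.ae hB] with ξ hξ
    simpa [B] using hξ
  -- the drift generates the decay caused by the jumps
  set H : Config N → ℂ := fun ξ => 2 * Real.pi *
    ((1 / 2) * ∑ k, ((‖R.symbol hb k ξ‖ ^ 2 : ℝ) : ℂ) - I * R.auxSymbol hb ξ - z) with hH
  have hHm : Measurable H := by
    have h1 : ∀ k, Measurable fun ξ => ((‖R.symbol hb k ξ‖ ^ 2 : ℝ) : ℂ) := fun k =>
      measurable_ofReal.comp ((R.measurable_symbol hb k).norm.pow_const 2)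
    have h2 : Measurable fun ξ => (R.auxSymbol hb ξ : ℂ) :=
      measurable_ofReal.comp (R.measurable_auxSymbol hb)
    exact ((((Finset.measurable_fun_sum _ fun k _ => h1 k).const_mul _).sub
      (h2.const_mul _)).sub_const _).const_mul _
  have hn2 : ∀ {γ : Config N → ℝ}, ContDiff ℝ ∞ γ → HasCompactSupport γ → ∀ k,
      MemLp (fun ξ => ((‖R.symbol hb k ξ‖ ^ 2 : ℝ) : ℂ) * γ ξ) 2 volume := fun hγ hγc k =>
    (Lp.memLp _).ae_eq (fourierL2_adjoint_mul_A (hdiss k) hγ hγc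
      (hdiss k _ (isMomentumTest_realTestWave hγ hγc)).2)
  have ha2 : ∀ {γ : Config N → ℝ}, ContDiff ℝ ∞ γ → HasCompactSupport γ →
      MemLp (fun ξ => (R.auxSymbol hb ξ : ℂ) * γ ξ) 2 volume := fun hγ hγc =>
    memLp_auxSymbol_mul_test hγ hγc (hdom _ (isMomentumTest_realTestWave hγ hγc)).2
  have hH2 : ∀ {γ : Config N → ℝ}, ContDiff ℝ ∞ γ → HasCompactSupport γ →
      MemLp (fun ξ => H ξ * γ ξ) 2 volume := by
    intro γ hγ hγc
    have h1 := ((((memLp_finsetSum Finset.univ fun k _ => hn2 hγ hγc k).const_mul (1 / 2)).sub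
      ((ha2 hγ hγc).const_mul I)).sub ((htest2 hγ hγc).const_mul z)).const_mul (2 * Real.pi : ℂ)
    refine h1.ae_eq (Eventually.of_forall fun ξ => ?_)
    simp only [Pi.sub_apply, hH, ← Finset.sum_mul]
    ring
  have hHul : LocallyIntegrable fun ξ => H ξ * u ξ := by
    refine locallyIntegrable_of_test fun γ hγ hγc => ?_
    refine ((hH2 hγ hγc).integrable_mul hu2).congr (Eventually.of_forall fun ξ => ?_)
    simp only [Pi.mul_apply]
    ring
  -- The second eigenvalue equation says that `H u` is the weak derivative of `u` along `κ_aux`; the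
  -- `2π` in `H` undoes the factor `I / (2π)` of the position operator.
  have hdist : ∀ γ : Config N → ℝ, ContDiff ℝ ∞ γ → HasCompactSupport γ →
      ∫ ξ, (fderiv ℝ γ ξ R.κaux) • u ξ = - ∫ ξ, γ ξ • (H ξ * u ξ) := by
    intro γ hγ hγc
    have hT := isMomentumTest_realTestWave hγ hγc
    have hR := hdom _ hT
    have e := (h _ hR hT).2
    have hd2 : MemLp (fun ξ => ((fderiv ℝ γ ξ R.κaux : ℝ) : ℂ)) 2 volume := by
      have hc : Continuous fun ξ => ((fderiv ℝ γ ξ R.κaux : ℝ) : ℂ) :=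
        continuous_ofReal.comp ((hγ.continuous_fderiv (by simp)).clm_apply continuous_const)
      exact hc.memLp_of_hasCompactSupport
        ((hγc.fderiv (𝕜 := ℝ)).comp_left (g := fun L : Config N →L[ℝ] ℝ => ((L R.κaux : ℝ) : ℂ))
          (by simp))
    have i1 := fun k => hu2.integrable_mul (hn2 hγ hγc k)
    have i2 := hu2.integrable_mul (ha2 hγ hγc)
    have i3 := hu2.integrable_mul (htest2 hγ hγc)
    have i4 := hu2.integrable_mul hd2
    simp only [Pi.mul_def] at i1 i2 i3 i4
    rw [Finset.sum_congr rfl fun k _ => huΨ (fourierL2_adjoint_mul_A (hdiss k) hγ hγc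
      (R.relDomain_diss hb hR k).2), huΨ (fourierL2_drift hγ hγc hR.2),
      huΨ (fourierL2_realTestWave hγ hγc)] at e
    have e2 : ∫ ξ, u ξ * (I / (2 * Real.pi) * (fderiv ℝ γ ξ R.κaux : ℝ) + R.auxSymbol hb ξ * γ ξ)
        = I / (2 * Real.pi) * (∫ ξ, u ξ * (fderiv ℝ γ ξ R.κaux : ℝ))
          + ∫ ξ, u ξ * (R.auxSymbol hb ξ * γ ξ) := by
      rw [← integral_const_mul, ← integral_add (i4.const_mul _) i2]
      congr 1; ext ξ; ring
    have i5 := (integrable_finsetSum Finset.univ fun k _ => i1 k).const_mul (1 / 2 : ℂ)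
    have i6 := i5.sub (i2.const_mul I)
    simp only [Pi.sub_def] at i6
    have e3 : ∫ ξ, γ ξ • (H ξ * u ξ) = 2 * Real.pi * ((1 / 2) * ∑ k, (∫ ξ, u ξ *
          (((‖R.symbol hb k ξ‖ ^ 2 : ℝ) : ℂ) * γ ξ))
        - I * (∫ ξ, u ξ * (R.auxSymbol hb ξ * γ ξ)) - z * ∫ ξ, u ξ * γ ξ) := by
      rw [← integral_finsetSum _ fun k _ => i1 k, ← integral_const_mul, ← integral_const_mul,
        ← integral_const_mul, ← integral_sub i5 (i2.const_mul I),
        ← integral_sub i6 (i3.const_mul z), ← integral_const_mul]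
      congr 1; ext ξ
      simp only [hH, real_smul, ← Finset.mul_sum, ← Finset.sum_mul]
      ring
    have e4 : ∫ ξ, (fderiv ℝ γ ξ R.κaux) • u ξ = ∫ ξ, u ξ * (fderiv ℝ γ ξ R.κaux : ℝ) := by
      congr 1; ext ξ; rw [real_smul, mul_comm]
    rw [e2] at e
    rw [e3, e4]
    have hI : I * (I / (2 * Real.pi)) = -(2 * Real.pi : ℂ)⁻¹ := by
      rw [← mul_div_assoc, I_mul_I, neg_div, one_div]
    have hpi2 : (2 * Real.pi : ℂ) * (2 * Real.pi : ℂ)⁻¹ = 1 := mul_inv_cancel₀ (by simp)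
    rw [mul_add, ← mul_assoc, hI] at e
    linear_combination (2 * Real.pi : ℂ) * e - (∫ ξ, u ξ * (fderiv ℝ γ ξ R.κaux : ℝ)) * hpi2
  -- passing to the momentum distribution
  have hP : Integrable fun ξ => ‖u ξ‖ ^ 2 := hu2.integrable_norm_pow (by norm_num)
  have hP0 : ∫ ξ, ‖u ξ‖ ^ 2 ≠ 0 := by
    intro h0
    rw [integral_eq_zero_iff_of_nonneg (fun ξ => by positivity) hP] at h0
    obtain ⟨ξ, h1, h2⟩ := (h0.and hne).exists
    apply h2
    simpa [hudef] using h1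
  -- The real part discards `f_aux`, the jump equation eliminates the symbols, and `2 Re z = ∑
  -- |cₖ|²` balances gain against loss.
  have hQ : ∀ᵐ ξ, 2 * (conj (u ξ) * (H ξ * u ξ)).re
      = 2 * Real.pi * ∑ k, ‖c k‖ ^ 2 * (‖u (ξ - R.kick k)‖ ^ 2 - ‖u ξ‖ ^ 2) := by
    filter_upwards [ae_all_iff.2 hjump] with ξ hξ
    have h1 : ∀ k, ‖R.symbol hb k ξ‖ ^ 2 * ‖u ξ‖ ^ 2
        = ‖c k‖ ^ 2 * ‖u (ξ - R.kick k)‖ ^ 2 := fun k => by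
      have := congrArg (fun x : ℂ => ‖x‖ ^ 2) (hξ k)
      simpa only [norm_mul, RCLike.norm_conj, mul_pow] using this
    have h2 : conj (u ξ) * (H ξ * u ξ) = ((‖u ξ‖ ^ 2 : ℝ) : ℂ) * H ξ := by
      rw [ofReal_pow, ← conj_mul']; ring
    have h3 : (H ξ).re = 2 * Real.pi * ((1 / 2) * ∑ k, ‖R.symbol hb k ξ‖ ^ 2 - z.re) := by
      have : H ξ = ((2 * Real.pi : ℝ) : ℂ) * ((((1 / 2) * ∑ k, ‖R.symbol hb k ξ‖ ^ 2 : ℝ) : ℂ)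
          - I * R.auxSymbol hb ξ - z) := by
        simp only [hH]; push_cast; ring
      rw [this, re_ofReal_mul, sub_re, sub_re, ofReal_re]
      simp
    rw [h2, re_ofReal_mul, h3]
    simp only [mul_sub, Finset.sum_sub_distrib, ← h1, ← Finset.sum_mul, ← hz]
    ring
  obtain ⟨hv, hk⟩ := jumps_and_drift_trivial hP hP0 (v := R.κaux) (d := fun k => ‖c k‖ ^ 2)
    (fun k => by positivity) hQ
    (fun s hs => ae_norm_sq_eq_line_integral hum (hHm.mul hum) hul hHul hdist hs)
  -- the symbols are constant
  have hsym : ∀ k, ∀ᵐ ξ, R.symbol hb k ξ = conj (c k) := by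
    intro k
    filter_upwards [hjump k, hne] with ξ h1 h2
    have hu0 : u ξ ≠ 0 := by simpa [hudef] using h2
    have h3 : conj (R.symbol hb k ξ) = c k := by
      apply mul_right_cancel₀ hu0
      rw [h1]
      rcases hk k with h4 | h4
      · have : c k = 0 := by simpa using h4
        rw [this, zero_mul, zero_mul]
      · rw [h4, sub_zero]
    rw [← h3, conj_conj]
  -- With `κ_aux = 0` the left side of `hdist` is zero; dividing by `u` then leaves `H = 0`, whose
  -- imaginary part fixes `f_aux`.
  have hH0 : ∀ᵐ ξ, H ξ * u ξ = 0 := by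
    refine ae_eq_zero_of_integral_contDiff_smul_eq_zero hHul fun γ hγ hγc => ?_
    have := hdist γ hγ hγc
    rw [hv] at this
    simpa using this.symm
  have haux : ∀ᵐ ξ, (R.auxSymbol hb ξ : ℂ) = ((-z.im : ℝ) : ℂ) := by
    filter_upwards [hH0, hne] with ξ h1 h2
    have hu0 : u ξ ≠ 0 := by simpa [hudef] using h2
    have h3 := (mul_eq_zero.1 h1).resolve_right hu0
    have h4 := (mul_eq_zero.1 h3).resolve_left (by exact_mod_cast Real.two_pi_pos.ne')
    have h5 := congrArg im h4
    have h6 : ((1 / 2 : ℂ) * ∑ k, ((‖R.symbol hb k ξ‖ ^ 2 : ℝ) : ℂ)).im = 0 := by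
      rw [← ofReal_sum, show (1 / 2 : ℂ) = ((1 / 2 : ℝ) : ℂ) by push_cast; rfl, ← ofReal_mul,
        ofReal_im]
    rw [sub_im, sub_im, h6, I_mul_im, ofReal_re, zero_im] at h5
    congr 1
    linarith
  constructor
  · intro k
    by_cases h0 : R.kick k = 0
    · have hκ : R.κ k = 0 := by
        simpa [kick, Real.pi_ne_zero] using h0
      exact ⟨_, IsScalar.opMul (isScalar_mulOp (c := 1) (Eventually.of_forall fun x => by
        simp [hκ])) (isScalar_momOp (hsym k))⟩
    · have hc0 : c k = 0 := by simpa using (hk k).resolve_right h0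
      have hm : IsScalar (momOp hb (R.f k)) 0 := isScalar_momOp (by simpa [hc0, symbol] using hsym k)
      refine ⟨0, fun φ => ?_⟩
      obtain ⟨h1, h2⟩ := hm φ
      obtain ⟨h3, h4⟩ := opMul_apply_of_mem h1 (mem_mulOp_phase (R.κ k) _)
      refine ⟨h3, h4.trans ?_⟩
      have h5 : momOp hb (R.f k) ⟨φ, h1⟩ = 0 := by rw [h2, zero_smul]
      rw [zero_smul]
      have h6 : (⟨momOp hb (R.f k) ⟨φ, h1⟩, mem_mulOp_phase (R.κ k) _⟩ :
        (mulOp fun x : Config N => cexp (-I * ((⟪R.κ k, x⟫_ℝ : ℝ) : ℂ))).domain) = 0 :=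
        Subtype.ext h5
      rw [h6, LinearPMap.map_zero]
  · refine ⟨-z.im, ?_⟩
    have := IsScalar.add (isScalar_mulOp (N := N) (g := fun x => ((⟪R.κaux, x⟫_ℝ : ℝ) : ℂ)) (c := 0)
      (Eventually.of_forall fun x => by simp [hv])) (isScalar_momOp (hb := hb)
        (f := fun p => (R.faux p : ℂ)) haux)
    rwa [zero_add] at this

end TransInvRelaxation

end NoGo

namespace NoGo

open Complex ComplexConjugate

/-! ### From the master equation to stationarity -/

variable {N K : ℕ} {R : TransInvRelaxation N K} {hb : ℝ} {H : Wave N →ₗ.[ℂ] Wave N}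

theorem commForm_pureState_eq_zero (hH : IsSelfAdjoint H) {Ψ : Wave N} {E : ℝ}
    (hΨ : Ψ ∈ H.domain) (hE : H ⟨Ψ, hΨ⟩ = (E : ℂ) • Ψ) (φ χ : Wave N) (hφ : φ ∈ H.domain)
    (hχ : χ ∈ H.domain) : commForm H (pureState Ψ) φ χ hφ hχ = 0 := by
  have hsym : ∀ x (hx : x ∈ H.domain), ⟪Ψ, H ⟨x, hx⟩⟫_ℂ = E * ⟪Ψ, x⟫_ℂ := by
    intro x hx
    have h := LinearPMap.adjoint_isFormalAdjoint hH.dense_domain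
    rw [LinearPMap.isSelfAdjoint_def.1 hH] at h
    have e := h ⟨Ψ, hΨ⟩ ⟨x, hx⟩
    rw [hE, inner_smul_left, conj_ofReal] at e
    exact e.symm
  simp only [commForm, inner_pureState, hsym, map_mul, conj_ofReal]
  ring

/-- With all unbounded operators acting on the fixed vectors, the generator is a finite combination
of matrix elements of the state, so weak convergence suffices. -/
theorem tendsto_genForm {ρ : ℝ → (Wave N →L[ℂ] Wave N)} {σ : Wave N →L[ℂ] Wave N}
    (h : SteersTo ρ σ) (φ χ : Wave N) (hφ : φ ∈ R.genDomain hb H) (hχ : χ ∈ R.genDomain hb H) :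
    Tendsto (fun t => R.genForm hb H (ρ t) φ χ hφ hχ) atTop
      (𝓝 (R.genForm hb H σ φ χ hφ hχ)) := by
  simp only [TransInvRelaxation.genForm, TransInvRelaxation.relForm, commForm, dissForm]
  refine (((h _ _).sub (h _ _)).const_mul _).add (Tendsto.sub ?_ (((h _ _).sub (h _ _)).const_mul _))
  exact tendsto_finsetSum _ fun k _ => (h _ _).sub (((h _ _).add (h _ _)).const_mul _)

namespace TransInvRelaxation

/-- On a pure state the form is built from inner products with `Ψ`, hence continuous along the
approximating sequences, which converge together with all their images. -/
theorem HasCore.relForm_pureState_eq_zero (hcore : R.HasCore hb H) {Ψ : Wave N}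
    (h : ∀ φ χ (hφ : φ ∈ R.genDomain hb H) (hχ : χ ∈ R.genDomain hb H),
      R.relForm hb (pureState Ψ) φ χ hφ.2 hχ.2 = 0)
    {φ χ : Wave N} (hφ : IsMomentumTest φ) (hχ : IsMomentumTest χ)
    (hφ' : φ ∈ R.relDomain hb) (hχ' : χ ∈ R.relDomain hb) :
    R.relForm hb (pureState Ψ) φ χ hφ' hχ' = 0 := by
  obtain ⟨_, u, u1, u2, u3, u4⟩ := hcore φ hφ
  obtain ⟨_, v, v1, v2, v3, v4⟩ := hcore χ hχ
  have hlim : Tendsto (fun n => R.relForm hb (pureState Ψ) (u n) (v n) (u n).2.2 (v n).2.2) atTop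
      (𝓝 (R.relForm hb (pureState Ψ) φ χ hφ' hχ')) := by
    simp only [relForm_pureState]
    have hi : ∀ {x : ℕ → Wave N} {y : Wave N}, Tendsto x atTop (𝓝 y) →
        Tendsto (fun n => ⟪Ψ, x n⟫_ℂ) atTop (𝓝 ⟪Ψ, y⟫_ℂ) := fun hx => tendsto_const_nhds.inner hx
    have hc : ∀ {x : ℕ → ℂ} {y : ℂ}, Tendsto x atTop (𝓝 y) →
        Tendsto (fun n => conj (x n)) atTop (𝓝 (conj y)) := fun hx =>
      (continuous_conj.tendsto _).comp hx
    refine Tendsto.sub (tendsto_finsetSum _ fun k _ => (hc (hi (u2 k))).mul (hi (v2 k)))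
      (((hc (Tendsto.sub (Tendsto.const_mul _ (tendsto_finsetSum _ fun k _ => hi (u3 k)))
        ((hi u4).const_mul _))).mul (hi v1)).add ((hc (hi u1)).mul
        (Tendsto.sub (Tendsto.const_mul _ (tendsto_finsetSum _ fun k _ => hi (v3 k)))
        ((hi v4).const_mul _))))
  refine tendsto_nhds_unique hlim ?_
  simp only [h _ _ (u _).2 (v _).2]
  exact tendsto_const_nhds

theorem mem_relDomain_of_isScalar {c : Fin K → ℂ} {r : ℝ} (hA : ∀ k, IsScalar (R.A hb k) (c k))
    (hD : IsScalar (R.drift hb) r) (φ : Wave N) : φ ∈ R.relDomain hb :=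
  ⟨(Submodule.mem_iInf _).2 fun k => (hA k).mem_dissDomain φ, (hD φ).1⟩

theorem relForm_eq_zero_of_isScalar {c : Fin K → ℂ} {r : ℝ} (hA : ∀ k, IsScalar (R.A hb k) (c k))
    (hD : IsScalar (R.drift hb) r) (ρ : Wave N →L[ℂ] Wave N) (φ χ : Wave N)
    (hφ : φ ∈ R.relDomain hb) (hχ : χ ∈ R.relDomain hb) : R.relForm hb ρ φ χ hφ hχ = 0 := by
  rw [relForm, hD.commForm_eq_zero (conj_ofReal r),
    Finset.sum_eq_zero fun k _ => (hA k).dissForm_eq_zero ρ φ χ _ _, mul_zero, sub_zero]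

end TransInvRelaxation

theorem fourierL2_ne_zero_of_momentumWave (hhb : 0 < hb) {Ψ : Wave N}
    (hne : ∀ᵐ p : Config N, momentumWave hb Ψ p ≠ 0) : ∀ᵐ ξ, fourierL2 N Ψ ξ ≠ 0 := by
  have hc : 2 * Real.pi * hb ≠ 0 := by positivity
  filter_upwards [(Measure.quasiMeasurePreserving_smul (volume : Measure (Config N)) hc).ae hne]
    with ξ hξ h0
  apply hξ
  rw [momentumWave, inv_smul_smul₀ hc, h0, mul_zero]

/-- A weakly stationary eigenstate of `H` forces the relaxation operators to be scalars. -/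
theorem exists_isScalar_of_genForm_eq_zero (hhb : 0 < hb) (hH : IsSelfAdjoint H) {Ψ : Wave N}
    (hnorm : ‖Ψ‖ = 1) {E : ℝ} (hΨ : Ψ ∈ H.domain) (hE : H ⟨Ψ, hΨ⟩ = (E : ℂ) • Ψ)
    (hne : ∀ᵐ p : Config N, momentumWave hb Ψ p ≠ 0) (hcore : R.HasCore hb H)
    (h : ∀ φ χ (hφ : φ ∈ R.genDomain hb H) (hχ : χ ∈ R.genDomain hb H),
      R.genForm hb H (pureState Ψ) φ χ hφ hχ = 0) :
    ∃ (c : Fin K → ℂ) (r : ℝ), (∀ k, IsScalar (R.A hb k) (c k)) ∧ IsScalar (R.drift hb) r := by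
  have hrel : ∀ φ χ (hφ : φ ∈ R.genDomain hb H) (hχ : χ ∈ R.genDomain hb H),
      R.relForm hb (pureState Ψ) φ χ hφ.2 hχ.2 = 0 := by
    intro φ χ hφ hχ
    have e := h φ χ hφ hχ
    rwa [TransInvRelaxation.genForm, commForm_pureState_eq_zero hH hΨ hE, mul_zero,
      zero_add] at e
  have hΨ0 : Ψ ≠ 0 := by
    rintro rfl
    simp at hnorm
  obtain ⟨hA, r, hD⟩ := TransInvRelaxation.isScalar_of_stationary hΨ0
    (fourierL2_ne_zero_of_momentumWave hhb hne) (fun φ hφ => (hcore φ hφ).1)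
    (fun φ χ hφ hχ => hcore.relForm_pureState_eq_zero hrel hφ hχ _ _)
  choose c hc using hA
  exact ⟨c, r, hc, hD⟩

end NoGo

theorem theorem1 (N : ℕ) (hb : ℝ) (hhb : 0 < hb) (m : Fin N → ℝ) (hm : ∀ n, 0 < m n)
    (U : NoGo.Config N → ℝ) (hU : Measurable U)
    (H : NoGo.Wave N →ₗ.[ℂ] NoGo.Wave N) (hH : NoGo.IsHamiltonian hb m U H)
    -- `Ψ` is a normalized eigenstate of `H`
    (Ψ : NoGo.Wave N) (hnorm : ‖Ψ‖ = 1) (E : ℝ)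
    (hΨ : Ψ ∈ H.domain) (hE : H ⟨Ψ, hΨ⟩ = (E : ℂ) • Ψ)
    -- with zero mean momentum
    (hint : ∀ n, Integrable (fun p : NoGo.Config N => p n * ‖NoGo.momentumWave hb Ψ p‖ ^ 2))
    (hmean : ∀ n, ∫ p : NoGo.Config N, p n * ‖NoGo.momentumWave hb Ψ p‖ ^ 2 = 0)
    -- and almost everywhere nonvanishing momentum-space wavefunction
    (hne : ∀ᵐ p : NoGo.Config N, NoGo.momentumWave hb Ψ p ≠ 0)
    (K : ℕ) (R : NoGo.TransInvRelaxation N K) (hcore : R.HasCore hb H) :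
    -- the only evolution that converges to `|Ψ⟩⟨Ψ|` is the one that stays there forever
    (∀ ρ : ℝ → (NoGo.Wave N →L[ℂ] NoGo.Wave N), R.IsSolution hb H ρ →
      NoGo.SteersTo ρ (NoGo.pureState Ψ) → ∀ t, 0 ≤ t → ρ t = NoGo.pureState Ψ) ∧
    -- and `|Ψ⟩⟨Ψ|` can be a fixed point only if the relaxation part vanishes identically
    (R.IsSolution hb H (fun _ => NoGo.pureState Ψ) →
      ∀ (ρ : NoGo.Wave N →L[ℂ] NoGo.Wave N) (φ χ : NoGo.Wave N)
        (hφ : φ ∈ R.relDomain hb) (hχ : χ ∈ R.relDomain hb), R.relForm hb ρ φ χ hφ hχ = 0) := by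

  constructor
  · intro ρ hρ hst t ht
    obtain ⟨c, r, hA, hD⟩ := NoGo.exists_isScalar_of_genForm_eq_zero hhb hH.selfAdjoint hnorm hΨ hE
      hne hcore fun φ χ hφ hχ => NoGo.deriv_limit_eq_zero (hρ.equation φ χ hφ hχ) (hst φ χ)
        (NoGo.tendsto_genForm hst φ χ hφ hχ)
    -- Scalar relaxation operators are defined everywhere, so `Ψ` itself becomes an admissible
    -- vector in the weak equation.
    have hΨd : Ψ ∈ R.genDomain hb H :=
      ⟨hΨ, NoGo.TransInvRelaxation.mem_relDomain_of_isScalar hA hD Ψ⟩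
    have hder : ∀ s, 0 ≤ s →
        HasDerivWithinAt (fun s => ⟪Ψ, ρ s Ψ⟫_ℂ) 0 (Set.Ici 0) s := by
      intro s hs
      have h := hρ.equation Ψ Ψ hΨd hΨd s hs
      have h0 : R.genForm hb H (ρ s) Ψ Ψ hΨd hΨd = 0 := by
        rw [NoGo.TransInvRelaxation.genForm,
          NoGo.TransInvRelaxation.relForm_eq_zero_of_isScalar hA hD, NoGo.commForm, hE, map_smul,
          inner_smul_left, inner_smul_right, Complex.conj_ofReal, sub_self, mul_zero, add_zero]
      rwa [h0] at h
    have hconst : ∀ s, 0 ≤ s → ⟪Ψ, ρ s Ψ⟫_ℂ = ⟪Ψ, ρ t Ψ⟫_ℂ := by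
      intro s hs
      have := Convex.norm_image_sub_le_of_norm_hasDerivWithin_le (C := 0)
        (fun x hx => hder x hx) (fun x _ => by simp) (convex_Ici 0) (Set.mem_Ici.2 ht)
        (Set.mem_Ici.2 hs)
      rw [zero_mul] at this
      exact sub_eq_zero.1 (norm_le_zero_iff.1 this)
    have hlim : Tendsto (fun s => ⟪Ψ, ρ s Ψ⟫_ℂ) atTop (𝓝 ⟪Ψ, ρ t Ψ⟫_ℂ) := by
      refine tendsto_const_nhds.congr' ?_
      filter_upwards [eventually_ge_atTop 0] with s hs
      exact (hconst s hs).symm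
    refine (hρ.density t ht).eq_rankOne hnorm ?_
    rw [tendsto_nhds_unique hlim (hst Ψ Ψ), NoGo.inner_pureState, inner_self_eq_norm_sq_to_K,
      hnorm]
    simp
  · intro hsol ρ φ χ hφ hχ
    obtain ⟨c, r, hA, hD⟩ := NoGo.exists_isScalar_of_genForm_eq_zero hhb hH.selfAdjoint hnorm hΨ hE
      hne hcore fun φ χ hφ hχ => by
        have h1 := hsol.equation φ χ hφ hχ 0 le_rfl
        have h2 := hasDerivWithinAt_const (0 : ℝ) (Set.Ici (0 : ℝ)) ⟪φ, NoGo.pureState Ψ χ⟫_ℂ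
        exact (uniqueDiffOn_Ici (0 : ℝ) 0 Set.self_mem_Ici).eq_deriv _ h1 h2
    exact NoGo.TransInvRelaxation.relForm_eq_zero_of_isScalar hA hD ρ φ χ hφ hχ
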